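/- Let $d\in\mathbb N$, let $\mathscr D=\mathscr D(\mathbb R^d)$ be the space of complex-valued compactly supported smooth functions, with $\langle f,g\rangle=\int\bar f g\,\mathrm dk$, let $\mathscr D'$ be its dual (the distributions), and write $\langle f,T\rangle=T(\bar f)$ for $f\in\mathscr D$, $T\in\mathscr D'$. Let $\varpi:\mathbb R^d\to\mathbb R$ be smooth with $\varpi\ge\mu$ for some $\mu>0$; smooth functions of $\varpi$ act on $\mathscr D$ by multiplication and on $\mathscr D'$ by transposition. Let $\mathbb W$ be the Weyl C*-algebra of the canonical commutation relations over $(\mathscr D,\operatorname{Im}\langle\cdot,\cdot\rangle)$, i.e. the C*-algebra (unique up to isomorphism) generated by nonzero elements $W(f)$, $f\in\mathscr D$, with $$W(f)^*=W(-f),\qquad W(f)W(g)=e^{-i\pi^2\operatorname{Im}\langle f,g\rangle}\,W(f+g).$$ For a source $v\in\mathscr D'$ let $\tau=(\tau(t))_{t\in\mathbb R}$ be the quantum van Hove--Miyatake dynamics, the group of $*$-automorphisms of $\mathbb W$ determined by $$\tau(t)[W(f)]=e^{2\pi i\operatorname{Re}\langle f,(e^{-it\varpi}-1)v/\varpi\rangle}\,W(e^{it\varpi}f).$$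 Then for every $v\in\mathscr D'$: 1. For every $0<\beta\le\infty$ there is exactly one normalized regular state $\omega_\beta$ on $\mathbb W$ (regular: $\lambda\mapsto\omega_\beta(W(\lambda f))$ is continuous on $\mathbb R$ for every $f\in\mathscr D$), the algebraic Gibbs state, such that $$\omega_\beta(W(f))=e^{-\frac{\pi^2}{2}\langle f,\coth(\beta\varpi/2)f\rangle}\,e^{2\pi i\operatorname{Re}\langle f,-v/\varpi\rangle}\qquad(f\in\mathscr D),$$ where $\coth(\beta\varpi/2):=1$ if $\beta=\infty$. 2. For every $0<\beta<\infty$, $\omega_\beta$ is a $(\tau,\beta)$-KMS state: for all $a,b\in\mathbb W$ and all $F(z)=\int_{\mathbb R}\varphi(\xi)e^{2\pi i\xi z}\,\mathrm d\xi$ with $\varphi\in\mathscr D(\mathbb R)$, $$\int_{\mathbb R}F(t-i\beta)\,\omega_\beta\bigl(a\,\tau(t)[b]\bigr)\,\mathrm dt=\int_{\mathbb R}F(t)\,\omega_\beta\bigl(\tau(t)[b]\,a\bigr)\,\mathrm dt,$$ both integrals being absolutely convergent. 3. $\omega_\beta\to\omega_\infty$ in the weak-* topology as $\beta\to\infty$.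 -/

import Mathlib

open MeasureTheory Filter Topology TopologicalSpace Complex
open scoped Distributions ComplexConjugate ENNReal

noncomputable section

namespace VanHove

/-! ## Test functions, distributions, multiplication operators -/

/-- Momentum space `ℝ^d`. -/
abbrev Momentum (d : ℕ) : Type := EuclideanSpace ℝ (Fin d)

/-- `𝓓(ℝ^d)`: complex valued smooth functions with compact support. -/
abbrev TestFn (d : ℕ) : Type := 𝓓((⊤ : Opens (Momentum d)), ℂ)

/-- `𝓓'(ℝ^d)`: continuous complex linear functionals on `𝓓(ℝ^d)` (with its LF topology). -/
abbrev Dist (d : ℕ) : Type := TestFn d →L[ℂ] ℂ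

/-- Multiplication of test functions by a smooth function `m`. -/
def mulTest {d : ℕ} (m : Momentum d → ℂ) (hm : ContDiff ℝ ((⊤ : ℕ∞) : WithTop ℕ∞) m) :
    TestFn d →L[ℂ] TestFn d :=
  TestFunction.limitCLM ℂ
    (fun f => ⟨fun k => f k * m k, f.contDiff.mul hm, f.hasCompactSupport.mul_right,
      fun _ _ => trivial⟩)
    (fun _ hK => TestFunction.ofSupportedInCLM ℂ hK ∘L
      ContDiffMapSupportedIn.bilinLeftCLM (ContinuousLinearMap.mul ℂ ℂ) hm)
    (fun _ _ _ => rfl)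

@[simp]
theorem mulTest_apply {d : ℕ} (m : Momentum d → ℂ)
    (hm : ContDiff ℝ ((⊤ : ℕ∞) : WithTop ℕ∞) m) (f : TestFn d)
    (k : Momentum d) : mulTest m hm f k = f k * m k := rfl

/-- Multiplication of distributions by a smooth function `m`: the transpose of `mulTest`. -/
def mulDist {d : ℕ} (m : Momentum d → ℂ) (hm : ContDiff ℝ ((⊤ : ℕ∞) : WithTop ℕ∞) m)
    (T : Dist d) : Dist d :=
  T.comp (mulTest m hm)

/-- Complex conjugation of test functions. -/
def conjTest {d : ℕ} (f : TestFn d) : TestFn d :=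
  TestFunction.postcompCLM (𝕜 := ℝ) (Complex.conjCLE : ℂ →L[ℝ] ℂ) f

@[simp]
theorem conjTest_apply {d : ℕ} (f : TestFn d) (k : Momentum d) :
    conjTest f k = conj (f k) := rfl

/-- The sesquilinear duality bracket `⟨f, T⟩ = T (conj f)` between `𝓓` and `𝓓'`. -/
def pairing {d : ℕ} (f : TestFn d) (T : Dist d) : ℂ := T (conjTest f)

/-- The `L²` inner product `⟨f, g⟩ = ∫ conj f g` on test functions. -/
def l2Inner {d : ℕ} (f g : TestFn d) : ℂ := ∫ k, conj (f k) * g k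

/-- The symplectic form `Im ⟨f, g⟩`. -/
def symp {d : ℕ} (f g : TestFn d) : ℝ := (l2Inner f g).im

theorem integrable_conj_mul {d : ℕ} (f g : TestFn d) :
    Integrable (fun k => conj (f k) * g k) := by
  refine Continuous.integrable_of_hasCompactSupport ?_ ?_
  · exact (Complex.continuous_conj.comp f.continuous).mul g.continuous
  · exact g.hasCompactSupport.mul_left

theorem symp_add_left {d : ℕ} (f g h : TestFn d) : symp (f + g) h = symp f h + symp g h := by
  simp only [symp, l2Inner]
  rw [← Complex.add_im, ← integral_add (integrable_conj_mul f h) (integrable_conj_mul g h)]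
  congr 2
  funext k
  simp [add_mul]

theorem symp_add_right {d : ℕ} (f g h : TestFn d) : symp f (g + h) = symp f g + symp f h := by
  simp only [symp, l2Inner]
  rw [← Complex.add_im, ← integral_add (integrable_conj_mul f g) (integrable_conj_mul f h)]
  congr 2
  funext k
  simp [mul_add]

theorem symp_swap {d : ℕ} (f g : TestFn d) : symp g f = -symp f g := by
  simp only [symp, l2Inner]
  rw [← Complex.conj_im, ← integral_conj]
  congr 2
  funext k
  simp [mul_comm]

/-- The symplectic form is non-degenerate. -/
theorem symp_nondeg {d : ℕ} (f : TestFn d) (h : ∀ g, symp f g = 0) : f = 0 := by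
  have h1 := h ((I : ℂ) • f)
  have h2 : l2Inner f ((I : ℂ) • f) = I * ((∫ k, ‖f k‖ ^ 2 : ℝ) : ℂ) := by
    rw [l2Inner, ← integral_complex_ofReal, ← integral_const_mul]
    congr 1; funext k
    change conj (f k) * (I * f k) = _
    push_cast
    rw [← Complex.conj_mul']; ring
  rw [symp, h2] at h1
  have h3 : ∫ k, ‖f k‖ ^ 2 = 0 := by
    rw [Complex.I_mul_im, Complex.ofReal_re] at h1; exact h1
  have hc : Continuous fun k => ‖f k‖ ^ 2 := by fun_prop
  have hi : Integrable (fun k => ‖f k‖ ^ 2) := hc.integrable_of_hasCompactSupport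
    (f.hasCompactSupport.comp_left (g := fun z => ‖z‖ ^ 2) (by simp))
  rw [integral_eq_zero_iff_of_nonneg (fun k => by positivity) hi] at h3
  have h4 := (hc.ae_eq_iff_eq volume continuous_zero).1 h3
  ext k
  simpa using congrFun h4 k

/-! ## The Weyl CCR algebra -/

/-- The Hilbert space `ℓ²(X)`. -/
abbrev Ell2 (X : Type) : Type := lp (fun _ : X => ℂ) 2

theorem memℓp_phasePerm {X : Type} (e : X ≃ X) (θ : X → ℝ) (ξ : Ell2 X) :
    Memℓp (fun x => Complex.exp (θ x * I) * ξ (e x)) 2 := by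
  have h := lp.memℓp ξ
  rw [memℓp_gen_iff (by norm_num)] at h ⊢
  simp only [norm_mul, Complex.norm_exp_ofReal_mul_I, one_mul]
  exact e.summable_iff.2 h

/-- The unitary `(U ξ)(x) = exp(i θ x) * ξ (e⁻¹ x)` on `ℓ²(X)` given by a bijection `e` and
phases `θ`. -/
def phasePerm {X : Type} (e : X ≃ X) (θ : X → ℝ) : Ell2 X ≃ₗᵢ[ℂ] Ell2 X where
  toFun ξ := ⟨fun x => Complex.exp (θ x * I) * ξ (e.symm x), memℓp_phasePerm e.symm θ ξ⟩
  invFun ξ := ⟨fun x => Complex.exp ((-θ (e x) : ℝ) * I) * ξ (e x),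
    memℓp_phasePerm e (fun x => -θ (e x)) ξ⟩
  map_add' ξ η := by
    refine lp.ext (funext fun x => ?_)
    exact mul_add _ _ _
  map_smul' a ξ := by
    refine lp.ext (funext fun x => ?_)
    exact mul_left_comm _ _ _
  left_inv ξ := by
    refine lp.ext (funext fun x => ?_)
    change Complex.exp ((-θ (e x) : ℝ) * I) * (Complex.exp (θ (e x) * I) * ξ (e.symm (e x))) = ξ x
    rw [← mul_assoc, ← Complex.exp_add]
    simp
  right_inv ξ := by
    refine lp.ext (funext fun x => ?_)
    change Complex.exp (θ x * I) *
      (Complex.exp ((-θ (e (e.symm x)) : ℝ) * I) * ξ (e (e.symm x))) = ξ x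
    rw [← mul_assoc, ← Complex.exp_add]
    simp
  norm_map' ξ := by
    rw [lp.norm_eq_tsum_rpow (by norm_num), lp.norm_eq_tsum_rpow (by norm_num)]
    congr 1
    refine Eq.trans ?_ (e.symm.tsum_eq (fun x => ‖ξ x‖ ^ (2 : ℝ≥0∞).toReal))
    refine tsum_congr fun x => ?_
    change ‖Complex.exp (θ x * I) * ξ (e.symm x)‖ ^ _ = _
    rw [norm_mul, Complex.norm_exp_ofReal_mul_I, one_mul]

theorem phasePerm_apply {X : Type} (e : X ≃ X) (θ : X → ℝ) (ξ : Ell2 X) (x : X) :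
    phasePerm e θ ξ x = Complex.exp (θ x * I) * ξ (e.symm x) := rfl

theorem phasePerm_symm_apply {X : Type} (e : X ≃ X) (θ : X → ℝ) (ξ : Ell2 X) (x : X) :
    (phasePerm e θ).symm ξ x = Complex.exp ((-θ (e x) : ℝ) * I) * ξ (e x) := rfl

/-- The Weyl operators on `ℓ²(𝓓)`: `W(f) δ_g = exp(-i π² Im ⟨f, g⟩) δ_{f + g}`. -/
def weylOp {d : ℕ} (f : TestFn d) : Ell2 (TestFn d) →L[ℂ] Ell2 (TestFn d) :=
  (phasePerm (Equiv.addLeft f) (fun h => -(Real.pi ^ 2 * symp f h))).toContinuousLinearEquiv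

/-- The algebra of canonical commutation relations over `(𝓓, Im ⟨·, ·⟩)`, as the norm closed
*-algebra of operators generated by the Weyl operators. The symplectic form being non-degenerate,
the C*-algebra generated by non-zero elements `W(f)` subject to the Weyl relations is unique up to
isomorphism, so this is that C*-algebra. -/
def weylSubalgebra (d : ℕ) :
    StarSubalgebra ℂ (Ell2 (TestFn d) →L[ℂ] Ell2 (TestFn d)) :=
  (StarAlgebra.adjoin ℂ (Set.range (weylOp (d := d)))).topologicalClosure

theorem isClosed_weylSubalgebra (d : ℕ) :
    IsClosed (weylSubalgebra d : Set (Ell2 (TestFn d) →L[ℂ] Ell2 (TestFn d))) :=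
  StarSubalgebra.isClosed_topologicalClosure _

/-- The Weyl CCR C*-algebra. -/
abbrev WeylAlgebra (d : ℕ) : Type := weylSubalgebra d

instance instCStarAlgebraWeyl (d : ℕ) : CStarAlgebra (WeylAlgebra d) :=
  StarSubalgebra.cstarAlgebra _ (h_closed := isClosed_weylSubalgebra d)

theorem weylOp_mem {d : ℕ} (f : TestFn d) : weylOp f ∈ weylSubalgebra d :=
  StarSubalgebra.le_topologicalClosure _ (StarAlgebra.subset_adjoin ℂ _ ⟨f, rfl⟩)

/-- The Weyl operator `W(f)` as an element of the Weyl algebra. -/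
def W {d : ℕ} (f : TestFn d) : WeylAlgebra d := ⟨weylOp f, weylOp_mem f⟩

theorem weylOp_apply {d : ℕ} (f : TestFn d) (ξ : Ell2 (TestFn d)) (h : TestFn d) :
    weylOp f ξ h = Complex.exp ((-(Real.pi ^ 2 * symp f h) : ℝ) * I) * ξ (-f + h) := rfl

theorem symp_self {d : ℕ} (f : TestFn d) : symp f f = 0 := by
  have := symp_swap f f
  linarith

theorem symp_neg_left {d : ℕ} (f g : TestFn d) : symp (-f) g = -symp f g := by
  have h0 : symp (0 : TestFn d) g = 0 := by simpa using symp_add_left (0 : TestFn d) 0 g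
  have h := symp_add_left (-f) f g
  rw [neg_add_cancel, h0] at h
  linarith

theorem symp_neg_right {d : ℕ} (f g : TestFn d) : symp f (-g) = -symp f g := by
  rw [symp_swap, symp_neg_left, symp_swap g f]

theorem weylOp_mul {d : ℕ} (f g : TestFn d) :
    weylOp f * weylOp g =
      Complex.exp (-(I * Real.pi ^ 2 * symp f g)) • weylOp (f + g) := by
  refine ContinuousLinearMap.ext fun ξ => lp.ext (funext fun h => ?_)
  have e1 : -g + (-f + h) = -(f + g) + h := by abel
  change weylOp f (weylOp g ξ) h = Complex.exp _ * weylOp (f + g) ξ h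
  simp only [weylOp_apply, e1, symp_add_left, symp_add_right, symp_neg_right]
  rw [← mul_assoc, ← mul_assoc, ← Complex.exp_add, ← Complex.exp_add]
  congr 2
  rw [symp_swap f g]
  push_cast
  ring

theorem weylOp_zero {d : ℕ} : weylOp (0 : TestFn d) = 1 := by
  have h0 (g : TestFn d) : symp (0 : TestFn d) g = 0 := by
    simpa using symp_add_left (0 : TestFn d) 0 g
  refine ContinuousLinearMap.ext fun ξ => lp.ext (funext fun h => ?_)
  change weylOp 0 ξ h = ξ h
  simp [weylOp_apply, h0]

/-- `W(f)* = W(-f)`. -/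
theorem star_weylOp {d : ℕ} (f : TestFn d) : star (weylOp f) = weylOp (-f) := by
  have h : weylOp (-f) * weylOp f = 1 := by
    rw [weylOp_mul, symp_neg_left, symp_self]
    simp [weylOp_zero]
  have h' : star (weylOp f) * weylOp f = 1 := by
    rw [ContinuousLinearMap.star_eq_adjoint]
    exact ContinuousLinearMap.norm_map_iff_adjoint_comp_self _ |>.1 fun ξ =>
      (phasePerm _ _).norm_map ξ
  have h'' : weylOp f * weylOp (-f) = 1 := by
    rw [weylOp_mul, symp_neg_right, symp_self]
    simp [weylOp_zero]
  calc star (weylOp f) = star (weylOp f) * (weylOp f * weylOp (-f)) := by rw [h'', mul_one]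
    _ = weylOp (-f) := by rw [← mul_assoc, h', one_mul]

/-- The Weyl relations. -/
theorem W_star {d : ℕ} (f : TestFn d) : star (W f) = W (-f) := Subtype.ext (star_weylOp f)

theorem W_mul {d : ℕ} (f g : TestFn d) :
    W f * W g = Complex.exp (-(I * Real.pi ^ 2 * symp f g)) • W (f + g) :=
  Subtype.ext (weylOp_mul f g)

theorem W_zero {d : ℕ} : W (0 : TestFn d) = 1 := Subtype.ext weylOp_zero

theorem W_ne_zero {d : ℕ} (f : TestFn d) : W f ≠ 0 := by
  classical
  intro hf
  have h : W (-f) * W f = 1 := by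
    rw [W_mul, symp_neg_left, symp_self, neg_add_cancel, W_zero]
    simp
  rw [hf, mul_zero] at h
  have h1 : (0 : Ell2 (TestFn d) →L[ℂ] Ell2 (TestFn d)) = 1 := congrArg Subtype.val h
  have h2 := congrArg (fun T : Ell2 (TestFn d) →L[ℂ] Ell2 (TestFn d) =>
    T (lp.single 2 (0 : TestFn d) (1 : ℂ)) (0 : TestFn d)) h1
  simp at h2

/-! ## The van Hove--Miyatake dynamics -/

/-- A dispersion relation: multiplication by a real function bounded below by a positive mass
which acts on `𝓓`, hence smooth. -/
structure Dispersion (d : ℕ) where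
  toFun : Momentum d → ℝ
  smooth : ContDiff ℝ ((⊤ : ℕ∞) : WithTop ℕ∞) toFun
  massive : ∃ μ : ℝ, 0 < μ ∧ ∀ k, μ ≤ toFun k

instance instCoeFunDispersion (d : ℕ) : CoeFun (Dispersion d) (fun _ => Momentum d → ℝ) :=
  ⟨Dispersion.toFun⟩

theorem Dispersion.pos {d : ℕ} (ϖ : Dispersion d) (k : Momentum d) : 0 < ϖ k := by
  obtain ⟨μ, h, h'⟩ := ϖ.massive
  exact h.trans_le (h' k)

theorem Dispersion.smooth_ofReal {d : ℕ} (ϖ : Dispersion d) :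
    ContDiff ℝ ((⊤ : ℕ∞) : WithTop ℕ∞) (fun k => (ϖ k : ℂ)) :=
  Complex.ofRealCLM.contDiff.comp ϖ.smooth

theorem Dispersion.smooth_exp {d : ℕ} (ϖ : Dispersion d) (t : ℝ) :
    ContDiff ℝ ((⊤ : ℕ∞) : WithTop ℕ∞) (fun k => Complex.exp (I * t * ϖ k)) :=
  (contDiff_const.mul ϖ.smooth_ofReal).cexp

theorem Dispersion.smooth_inv {d : ℕ} (ϖ : Dispersion d) :
    ContDiff ℝ ((⊤ : ℕ∞) : WithTop ℕ∞) (fun k => ((ϖ k : ℂ))⁻¹) := by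
  have h : ContDiff ℝ ((⊤ : ℕ∞) : WithTop ℕ∞) (fun k => (ϖ k)⁻¹) :=
    ϖ.smooth.inv fun k => (ϖ.pos k).ne'
  have := Complex.ofRealCLM.contDiff (n := ((⊤ : ℕ∞) : WithTop ℕ∞)) |>.comp h
  simpa [Function.comp_def] using this

theorem Dispersion.smooth_exp_sub_one {d : ℕ} (ϖ : Dispersion d) (t : ℝ) :
    ContDiff ℝ ((⊤ : ℕ∞) : WithTop ℕ∞) (fun k => Complex.exp (I * t * ϖ k) - 1) :=
  (ϖ.smooth_exp t).sub contDiff_const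

/-- `exp(i t ϖ) f`. -/
def evolve {d : ℕ} (ϖ : Dispersion d) (t : ℝ) : TestFn d →L[ℂ] TestFn d :=
  mulTest (fun k => Complex.exp (I * t * ϖ k)) (ϖ.smooth_exp t)

theorem evolve_apply {d : ℕ} (ϖ : Dispersion d) (t : ℝ) (f : TestFn d) (k : Momentum d) :
    evolve ϖ t f k = f k * Complex.exp (I * t * ϖ k) := rfl

theorem evolve_evolve {d : ℕ} (ϖ : Dispersion d) (s t : ℝ) (f : TestFn d) :
    evolve ϖ s (evolve ϖ t f) = evolve ϖ (s + t) f := by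
  ext k
  rw [evolve_apply, evolve_apply, evolve_apply, mul_assoc, ← Complex.exp_add]
  congr 2
  push_cast
  ring

theorem evolve_zero {d : ℕ} (ϖ : Dispersion d) (f : TestFn d) : evolve ϖ 0 f = f := by
  ext k
  simp [evolve_apply]

theorem symp_evolve {d : ℕ} (ϖ : Dispersion d) (t : ℝ) (f g : TestFn d) :
    symp (evolve ϖ t f) (evolve ϖ t g) = symp f g := by
  simp only [symp, l2Inner]
  congr 2
  funext k
  have h : conj (Complex.exp (I * t * ϖ k)) * Complex.exp (I * t * ϖ k) = 1 := by
    rw [← Complex.exp_conj, ← Complex.exp_add]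
    simp
  rw [evolve_apply, evolve_apply, map_mul]
  linear_combination (conj (f k) * g k) * h

/-- `exp(i t ϖ)` as a bijection of `𝓓`. -/
def evolveEquiv {d : ℕ} (ϖ : Dispersion d) (t : ℝ) : TestFn d ≃ TestFn d where
  toFun := evolve ϖ t
  invFun := evolve ϖ (-t)
  left_inv f := by rw [evolve_evolve, neg_add_cancel, evolve_zero]
  right_inv f := by rw [evolve_evolve, add_neg_cancel, evolve_zero]

/-- The distribution `v / ϖ`. -/
def divDisp {d : ℕ} (ϖ : Dispersion d) (v : Dist d) : Dist d :=
  mulDist (fun k => (ϖ k : ℂ)⁻¹) ϖ.smooth_inv v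

/-- The phase `2π Re ⟨f, (exp(-i t ϖ) - 1) v / ϖ⟩`. -/
def sourcePhase {d : ℕ} (ϖ : Dispersion d) (v : Dist d) (t : ℝ) (f : TestFn d) : ℝ :=
  2 * Real.pi * (pairing f (mulDist (fun k => Complex.exp (I * (-t : ℝ) * ϖ k) - 1)
    (ϖ.smooth_exp_sub_one (-t)) (divDisp ϖ v))).re

theorem conjTest_add {d : ℕ} (f g : TestFn d) :
    conjTest (f + g) = conjTest f + conjTest g := by
  ext k
  simp

theorem pairing_add {d : ℕ} (f g : TestFn d) (T : Dist d) :
    pairing (f + g) T = pairing f T + pairing g T := by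
  rw [pairing, conjTest_add, map_add]
  rfl

theorem sourcePhase_add {d : ℕ} (ϖ : Dispersion d) (v : Dist d) (t : ℝ) (f g : TestFn d) :
    sourcePhase ϖ v t (f + g) = sourcePhase ϖ v t f + sourcePhase ϖ v t g := by
  simp only [sourcePhase, pairing_add, Complex.add_re]
  ring

/-- The unitary `δ_f ↦ exp(2π i Re ⟨f, (exp(-i t ϖ) - 1) v / ϖ⟩) δ_{exp(i t ϖ) f}` on `ℓ²(𝓓)`,
which implements the dynamics. -/
def dynUnitary {d : ℕ} (ϖ : Dispersion d) (v : Dist d) (t : ℝ) :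
    Ell2 (TestFn d) ≃ₗᵢ[ℂ] Ell2 (TestFn d) :=
  phasePerm (evolveEquiv ϖ t) (fun h => sourcePhase ϖ v t (evolve ϖ (-t) h))

theorem conj_weylOp {d : ℕ} (ϖ : Dispersion d) (v : Dist d) (t : ℝ) (f : TestFn d) :
    (dynUnitary ϖ v t).conjStarAlgEquiv (weylOp f) =
      Complex.exp (I * sourcePhase ϖ v t f) • weylOp (evolve ϖ t f) := by
  refine ContinuousLinearMap.ext fun ξ => lp.ext (funext fun h => ?_)
  change Complex.exp (sourcePhase ϖ v t (evolve ϖ (-t) h) * I) *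
      (Complex.exp ((-(Real.pi ^ 2 * symp f (evolve ϖ (-t) h)) : ℝ) * I) *
        (Complex.exp ((-sourcePhase ϖ v t
            (evolve ϖ (-t) (evolve ϖ t (-f + evolve ϖ (-t) h))) : ℝ) * I) *
          ξ (evolve ϖ t (-f + evolve ϖ (-t) h)))) =
    Complex.exp (I * sourcePhase ϖ v t f) *
      (Complex.exp ((-(Real.pi ^ 2 * symp (evolve ϖ t f) h) : ℝ) * I) *
        ξ (-evolve ϖ t f + h))
  obtain ⟨g, rfl⟩ : ∃ g, h = evolve ϖ t g := ⟨evolve ϖ (-t) h, by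
    rw [evolve_evolve, add_neg_cancel, evolve_zero]⟩
  have e1 (g : TestFn d) : evolve ϖ (-t) (evolve ϖ t g) = g := by
    rw [evolve_evolve, neg_add_cancel, evolve_zero]
  have e2 : sourcePhase ϖ v t (-f + g) = sourcePhase ϖ v t g - sourcePhase ϖ v t f := by
    have := sourcePhase_add ϖ v t f (-f + g)
    rw [add_neg_cancel_left] at this
    linarith
  rw [e1, e1, e2, symp_evolve, map_add, map_neg]
  simp only [← mul_assoc, ← Complex.exp_add]
  congr 2
  push_cast
  ring

theorem conj_mem {d : ℕ} (ϖ : Dispersion d) (v : Dist d) (t : ℝ)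
    {a : Ell2 (TestFn d) →L[ℂ] Ell2 (TestFn d)} (ha : a ∈ weylSubalgebra d) :
    (dynUnitary ϖ v t).conjStarAlgEquiv a ∈ weylSubalgebra d := by
  let Φ := (dynUnitary ϖ v t).conjStarAlgEquiv
  have hc : Continuous Φ := by
    change Continuous fun x : Ell2 (TestFn d) →L[ℂ] Ell2 (TestFn d) =>
      ((dynUnitary ϖ v t).toContinuousLinearEquiv :
        Ell2 (TestFn d) →L[ℂ] Ell2 (TestFn d)) ∘L x ∘L
      ((dynUnitary ϖ v t).symm.toContinuousLinearEquiv :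
        Ell2 (TestFn d) →L[ℂ] Ell2 (TestFn d))
    fun_prop
  have h1 : weylSubalgebra d ≤ (weylSubalgebra d).comap Φ.toStarAlgHom := by
    refine StarSubalgebra.topologicalClosure_minimal (StarAlgebra.adjoin_le ?_)
      ((isClosed_weylSubalgebra d).preimage hc)
    rintro _ ⟨f, rfl⟩
    change Φ (weylOp f) ∈ weylSubalgebra d
    rw [conj_weylOp]
    exact SMulMemClass.smul_mem _ (weylOp_mem _)
  exact h1 ha

theorem sourcePhase_cocycle {d : ℕ} (ϖ : Dispersion d) (v : Dist d) (s t : ℝ) (f : TestFn d) :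
    sourcePhase ϖ v t f + sourcePhase ϖ v s (evolve ϖ t f) = sourcePhase ϖ v (s + t) f := by
  simp only [sourcePhase, ← mul_add, ← Complex.add_re, pairing, mulDist,
    ContinuousLinearMap.comp_apply, ← map_add]
  congr 3
  ext k
  have h : conj (Complex.exp (I * t * ϖ k)) = Complex.exp (I * (-t : ℝ) * ϖ k) := by
    rw [← Complex.exp_conj]
    simp
  have h' : Complex.exp (I * (-(s + t) : ℝ) * ϖ k) =
      Complex.exp (I * (-t : ℝ) * ϖ k) * Complex.exp (I * (-s : ℝ) * ϖ k) := by
    rw [← Complex.exp_add]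
    congr 1
    push_cast
    ring
  simp only [add_apply, mulTest_apply, conjTest_apply, evolve_apply, map_mul, h, h']
  ring

theorem dynUnitary_comp {d : ℕ} (ϖ : Dispersion d) (v : Dist d) (s t : ℝ)
    (ξ : Ell2 (TestFn d)) :
    dynUnitary ϖ v s (dynUnitary ϖ v t ξ) = dynUnitary ϖ v (s + t) ξ := by
  refine lp.ext (funext fun h => ?_)
  change Complex.exp (sourcePhase ϖ v s (evolve ϖ (-s) h) * I) *
      (Complex.exp (sourcePhase ϖ v t (evolve ϖ (-t) (evolve ϖ (-s) h)) * I) *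
        ξ (evolve ϖ (-t) (evolve ϖ (-s) h))) =
    Complex.exp (sourcePhase ϖ v (s + t) (evolve ϖ (-(s + t)) h) * I) *
      ξ (evolve ϖ (-(s + t)) h)
  have e1 : evolve ϖ (-t) (evolve ϖ (-s) h) = evolve ϖ (-(s + t)) h := by
    rw [evolve_evolve]
    congr 2
    ring
  have e2 : evolve ϖ t (evolve ϖ (-(s + t)) h) = evolve ϖ (-s) h := by
    rw [evolve_evolve]
    congr 2
    ring
  rw [e1, ← sourcePhase_cocycle, e2, ← mul_assoc, ← Complex.exp_add]
  congr 2
  push_cast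
  ring

theorem dynUnitary_zero {d : ℕ} (ϖ : Dispersion d) (v : Dist d) (ξ : Ell2 (TestFn d)) :
    dynUnitary ϖ v 0 ξ = ξ := by
  apply (dynUnitary ϖ v 0).injective
  rw [dynUnitary_comp, add_zero]

theorem dynUnitary_symm {d : ℕ} (ϖ : Dispersion d) (v : Dist d) (t : ℝ) :
    (dynUnitary ϖ v t).symm = dynUnitary ϖ v (-t) := by
  ext1 ξ
  rw [LinearIsometryEquiv.symm_apply_eq, dynUnitary_comp, add_neg_cancel, dynUnitary_zero]

theorem conj_symm_mem {d : ℕ} (ϖ : Dispersion d) (v : Dist d) (t : ℝ)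
    {a : Ell2 (TestFn d) →L[ℂ] Ell2 (TestFn d)} (ha : a ∈ weylSubalgebra d) :
    (dynUnitary ϖ v t).conjStarAlgEquiv.symm a ∈ weylSubalgebra d := by
  rw [LinearIsometryEquiv.symm_conjStarAlgEquiv, dynUnitary_symm]
  exact conj_mem ϖ v (-t) ha

/-- The quantum van Hove--Miyatake dynamical map `τ(t)` with source `v`, a *-automorphism of the
Weyl algebra; it is determined by its values on Weyl operators, see `vhmDynamics_W`. -/
def vhmDynamics {d : ℕ} (ϖ : Dispersion d) (v : Dist d) (t : ℝ) :
    WeylAlgebra d ≃⋆ₐ[ℂ] WeylAlgebra d where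
  toFun a := ⟨(dynUnitary ϖ v t).conjStarAlgEquiv a, conj_mem ϖ v t a.2⟩
  invFun a := ⟨(dynUnitary ϖ v t).conjStarAlgEquiv.symm a, conj_symm_mem ϖ v t a.2⟩
  left_inv _ := Subtype.ext ((dynUnitary ϖ v t).conjStarAlgEquiv.symm_apply_apply _)
  right_inv _ := Subtype.ext ((dynUnitary ϖ v t).conjStarAlgEquiv.apply_symm_apply _)
  map_mul' a b := Subtype.ext (map_mul (dynUnitary ϖ v t).conjStarAlgEquiv a.1 b.1)
  map_add' a b := Subtype.ext (map_add (dynUnitary ϖ v t).conjStarAlgEquiv a.1 b.1)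
  map_star' a := Subtype.ext (map_star (dynUnitary ϖ v t).conjStarAlgEquiv a.1)
  map_smul' c a := Subtype.ext (map_smul (dynUnitary ϖ v t).conjStarAlgEquiv c a.1)

/-- `τ(t)[W(f)] = exp(2π i Re ⟨f, (exp(-i t ϖ) - 1) v / ϖ⟩) W(exp(i t ϖ) f)`. -/
theorem vhmDynamics_W {d : ℕ} (ϖ : Dispersion d) (v : Dist d) (t : ℝ) (f : TestFn d) :
    vhmDynamics ϖ v t (W f) = Complex.exp (I * sourcePhase ϖ v t f) • W (evolve ϖ t f) :=
  Subtype.ext (conj_weylOp ϖ v t f)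

/-- The group law `τ(s) ∘ τ(t) = τ(s + t)`. -/
theorem vhmDynamics_add {d : ℕ} (ϖ : Dispersion d) (v : Dist d) (s t : ℝ) (a : WeylAlgebra d) :
    vhmDynamics ϖ v s (vhmDynamics ϖ v t a) = vhmDynamics ϖ v (s + t) a := by
  refine Subtype.ext (ContinuousLinearMap.ext fun ξ => ?_)
  change dynUnitary ϖ v s (dynUnitary ϖ v t (a.1 ((dynUnitary ϖ v t).symm
    ((dynUnitary ϖ v s).symm ξ)))) =
      dynUnitary ϖ v (s + t) (a.1 ((dynUnitary ϖ v (s + t)).symm ξ))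
  rw [dynUnitary_comp, dynUnitary_symm, dynUnitary_symm, dynUnitary_symm, dynUnitary_comp,
    neg_add_rev]

/-! ## States, KMS states, Gibbs states -/

/-- A continuous linear functional on a unital C*-algebra is a state if it is positive and
normalized. -/
structure IsState {A : Type*} [CStarAlgebra A] (ω : WeakDual ℂ A) : Prop where
  nonneg : ∀ a : A, 0 ≤ (ω (star a * a)).re ∧ (ω (star a * a)).im = 0
  map_one : ω 1 = 1

/-- The entire function `F(z) = ∫ φ(ξ) exp(2π i ξ z) dξ`, which restricts on `ℝ` to the inverse
Fourier transform of the test function `φ`. -/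
def invFourier (φ : 𝓓((⊤ : Opens ℝ), ℂ)) (z : ℂ) : ℂ :=
  ∫ ξ : ℝ, φ ξ * Complex.exp (2 * Real.pi * I * ξ * z)

/-- `(τ, β)`-KMS states: states `ω` with
`∫ F(t - iβ) ω(a τ(t)[b]) dt = ∫ F(t) ω(τ(t)[b] a) dt` (both integrals converging absolutely)
for all observables `a`, `b` and all inverse Fourier transforms `F` of test functions. -/
structure IsKMSState {A : Type*} [CStarAlgebra A] (τ : ℝ → A ≃⋆ₐ[ℂ] A) (β : ℝ)
    (ω : WeakDual ℂ A) : Prop where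
  isState : IsState ω
  integrable_left : ∀ (φ : 𝓓((⊤ : Opens ℝ), ℂ)) (a b : A),
    Integrable (fun t : ℝ => invFourier φ (t - I * β) * ω (a * τ t b))
  integrable_right : ∀ (φ : 𝓓((⊤ : Opens ℝ), ℂ)) (a b : A),
    Integrable (fun t : ℝ => invFourier φ t * ω (τ t b * a))
  kms : ∀ (φ : 𝓓((⊤ : Opens ℝ), ℂ)) (a b : A),
    ∫ t : ℝ, invFourier φ (t - I * β) * ω (a * τ t b) =
      ∫ t : ℝ, invFourier φ t * ω (τ t b * a)

/-- `coth(β x / 2)` for an inverse temperature `0 < β ≤ ∞` and `x > 0`; it is `1` at `β = ∞`. -/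
def cothHalf (β : ℝ≥0∞) (x : ℝ) : ℝ :=
  if β = ∞ then 1 else Real.cosh (β.toReal * x / 2) / Real.sinh (β.toReal * x / 2)

/-- The quadratic form `⟨f, coth(β ϖ / 2) f⟩`. -/
def thermalForm {d : ℕ} (ϖ : Dispersion d) (β : ℝ≥0∞) (f : TestFn d) : ℂ :=
  ∫ k, conj (f k) * ((cothHalf β (ϖ k) : ℂ) * f k)

/-- The noncommutative Fourier transform
`exp(-(π²/2) ⟨f, coth(β ϖ / 2) f⟩) exp(2π i Re ⟨f, -v / ϖ⟩)` of the Gibbs state. -/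
def gibbsFourier {d : ℕ} (ϖ : Dispersion d) (v : Dist d) (β : ℝ≥0∞) (f : TestFn d) : ℂ :=
  Complex.exp (-(Real.pi ^ 2 / 2) * thermalForm ϖ β f) *
    Complex.exp (2 * Real.pi * I * ((pairing f (-divDisp ϖ v)).re : ℂ))

/-- `ω` is the algebraic Gibbs state at inverse temperature `0 < β ≤ ∞`: the normalized regular
state with noncommutative Fourier transform `gibbsFourier ϖ v β`. -/
structure IsGibbsState {d : ℕ} (ϖ : Dispersion d) (v : Dist d) (β : ℝ≥0∞)
    (ω : WeakDual ℂ (WeylAlgebra d)) : Prop where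
  isState : IsState ω
  regular : ∀ f : TestFn d, Continuous fun r : ℝ => ω (W (r • f))
  fourier : ∀ f : TestFn d, ω (W f) = gibbsFourier ϖ v β f

end VanHove

/-!
The Gibbs state is determined by its values `φ(f) = ω(W(f))` on the Weyl operators, because their
linear span is dense (`weyl_induction`). Everything rests on the identity
`exp_symp_mul_gibbsFourier_add`,
`ω(W(f) W(g)) = φ(f) φ(g) exp(-π² K(f, g))`, with
`K(f, g) = ⟨f, (c + 1)/2 g⟩ + ⟨g, (c - 1)/2 f⟩` and `c = coth(β ϖ / 2)`.

*Existence.* Since `c ≥ 1`, the kernel `K` is positive semidefinite, hence so is its entrywise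
exponential, by the Schur product theorem. So `φ` is positive definite in the sense twisted by the
symplectic form (`weylKernel_gibbsFourier_posSemidef`). The Weyl algebra is realized on `ℓ²(𝓓)`, and
a positive functional on the algebraic span has to be shown to be bounded in the operator norm. This
is where the amenability of the abelian group `𝓓` enters: for a finite set `F ⊆ 𝓓`, the functional
`kernelFunctional (weylKernel φ) F`, a finite sum of matrix elements, is a state with the value
`φ(f) |F ∩ (F - f)| / |F|` on `W(f)`. Følner sets (`exists_foelner_set`) and weak-* compactness
yield a state with the values `φ` (`exists_isState_of_posSemidef`).

*KMS condition.* The source `v` enters the Gibbs state through a phase which is exactly transported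
by the dynamics, so that
`ω(W(g) τ(t)[W(f)]) = φ(g) φ(f) exp(-π² K(g, exp(i t ϖ) f))`, and in the opposite order
the arguments of `K` are exchanged. The first function extends to an entire function of `t`, bounded
on strips, and since `(c + 1)/2 * exp(-β ϖ) = (c - 1)/2` its value at `t + i β` is the second one
(`gibbsKernelExt_add_I`). As `invFourier φ` is entire and decays quadratically on strips, for test
functions `φ` on `ℝ` (`exists_invFourier_decay`), the KMS condition on
Weyl operators is a shift of the contour of integration (`integral_eq_integral_add_I`). Both of its
sides are continuous bilinear functionals of the observables, so it extends by density.

*Zero temperature limit.* On Weyl operators this is dominated convergence of the thermal form; it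
extends by density, since states have norm at most one (`IsState.norm_apply_le`).
-/

namespace VanHove

/-! ### States and density of the Weyl operators -/

open scoped ComplexOrder in
/-- By the Cauchy--Schwarz inequality in the GNS space, a state has norm at most one. -/
theorem IsState.norm_apply_le {A : Type*} [CStarAlgebra A] {ω : WeakDual ℂ A} (h : IsState ω)
    (a : A) : ‖ω a‖ ≤ ‖a‖ := by
  let _ : PartialOrder A := CStarAlgebra.spectralOrder A
  have _ : StarOrderedRing A := CStarAlgebra.spectralOrderedRing A
  let p : A →ₚ[ℂ] ℂ := PositiveLinearMap.mk₀ (ω : A →L[ℂ] ℂ).toLinearMap (by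
    intro x hx
    obtain ⟨b, rfl⟩ := CStarAlgebra.nonneg_iff_eq_star_mul_self.1 hx
    exact Complex.nonneg_iff.2 ⟨(h.nonneg b).1, (h.nonneg b).2.symm⟩)
  have hp (x : A) : p x = ω x := rfl
  have h1 : ‖p.toPreGNS 1‖ ^ 2 = 1 := by
    have := p.preGNS_norm_sq (p.toPreGNS 1)
    rw [p.ofPreGNS_toPreGNS, star_one, mul_one, hp, h.map_one] at this
    exact_mod_cast this
  have h2 : ‖p.toPreGNS a‖ ^ 2 ≤ ‖a‖ ^ 2 := by
    have e := p.preGNS_norm_sq (p.toPreGNS a)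
    rw [p.ofPreGNS_toPreGNS] at e
    have e' := congrArg norm e
    have b := p.norm_apply_le_of_nonneg (star a * a) (star_mul_self_nonneg a)
    rw [hp 1, h.map_one, norm_one, one_mul, CStarRing.norm_star_mul_self] at b
    rw [norm_pow, Complex.norm_real, norm_norm] at e'
    rw [e', sq ‖a‖]
    exact b
  have h3 := norm_inner_le_norm (𝕜 := ℂ) (p.toPreGNS 1) (p.toPreGNS a)
  rw [p.preGNS_inner_def, p.ofPreGNS_toPreGNS, p.ofPreGNS_toPreGNS, star_one, one_mul, hp] at h3
  have h1' : ‖p.toPreGNS 1‖ = 1 := (pow_eq_one_iff_of_nonneg (norm_nonneg _) two_ne_zero).1 h1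
  rw [h1', one_mul] at h3
  exact h3.trans ((sq_le_sq₀ (norm_nonneg _) (norm_nonneg _)).1 h2)

theorem weylOp_mul_mem_span {d : ℕ} {a b : Ell2 (TestFn d) →L[ℂ] Ell2 (TestFn d)}
    (ha : a ∈ Submodule.span ℂ (Set.range (weylOp (d := d))))
    (hb : b ∈ Submodule.span ℂ (Set.range (weylOp (d := d)))) :
    a * b ∈ Submodule.span ℂ (Set.range (weylOp (d := d))) := by
  induction ha, hb using Submodule.span_induction₂ with
  | mem_mem x y hx hy =>
    obtain ⟨f, rfl⟩ := hx
    obtain ⟨g, rfl⟩ := hy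
    rw [weylOp_mul]
    exact Submodule.smul_mem _ _ (Submodule.subset_span ⟨_, rfl⟩)
  | zero_left y hy => simp
  | zero_right y hy => simp
  | add_left x y z _ _ _ h1 h2 => rw [add_mul]; exact add_mem h1 h2
  | add_right x y z _ _ _ h1 h2 => rw [mul_add]; exact add_mem h1 h2
  | smul_left r x y _ _ h => rw [smul_mul_assoc]; exact Submodule.smul_mem _ _ h
  | smul_right r x y _ _ h => rw [mul_smul_comm]; exact Submodule.smul_mem _ _ h

/-- By the Weyl relations, the *-algebra generated by the Weyl operators is their linear span. -/
theorem mem_span_weylOp {d : ℕ} {a : Ell2 (TestFn d) →L[ℂ] Ell2 (TestFn d)}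
    (ha : a ∈ StarAlgebra.adjoin ℂ (Set.range (weylOp (d := d)))) :
    a ∈ Submodule.span ℂ (Set.range (weylOp (d := d))) := by
  induction ha using StarAlgebra.adjoin_induction with
  | mem x hx => exact Submodule.subset_span hx
  | algebraMap r =>
    rw [Algebra.algebraMap_eq_smul_one, ← weylOp_zero]
    exact Submodule.smul_mem _ _ (Submodule.subset_span ⟨_, rfl⟩)
  | add x y _ _ hx hy => exact add_mem hx hy
  | mul x y _ _ hx hy => exact weylOp_mul_mem_span hx hy
  | star x hx' hx =>
    clear hx'
    induction hx using Submodule.span_induction with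
    | mem x hx =>
      obtain ⟨f, rfl⟩ := hx
      rw [star_weylOp]
      exact Submodule.subset_span ⟨_, rfl⟩
    | zero => simp
    | add x y _ _ hx hy => rw [star_add]; exact add_mem hx hy
    | smul r x _ hx => rw [star_smul]; exact Submodule.smul_mem _ _ hx

/-- Induction principle expressing that the linear span of the Weyl operators is dense in the Weyl
algebra. -/
theorem weyl_induction {d : ℕ} {p : WeylAlgebra d → Prop} (closed : IsClosed {a | p a})
    (weyl : ∀ f, p (W f)) (zero : p 0) (add : ∀ a b, p a → p b → p (a + b))
    (smul : ∀ (c : ℂ) a, p a → p (c • a)) (a : WeylAlgebra d) : p a := by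
  have key : ∀ b ∈ Submodule.span ℂ (Set.range (weylOp (d := d))),
      ∃ h : b ∈ weylSubalgebra d, p ⟨b, h⟩ := by
    intro b hb
    induction hb using Submodule.span_induction with
    | mem x hx =>
      obtain ⟨f, rfl⟩ := hx
      exact ⟨weylOp_mem f, weyl f⟩
    | zero => exact ⟨zero_mem _, zero⟩
    | add x y _ _ hx hy => exact ⟨add_mem hx.1 hy.1, add _ _ hx.2 hy.2⟩
    | smul c x _ hx => exact ⟨SMulMemClass.smul_mem c hx.1, smul c _ hx.2⟩
  have ha : a ∈ closure {b : WeylAlgebra d | p b} := by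
    rw [closure_subtype]
    refine closure_mono ?_ a.2
    intro b hb
    obtain ⟨h, hp⟩ := key b (mem_span_weylOp hb)
    exact ⟨⟨b, h⟩, hp, rfl⟩
  exact closed.closure_subset ha

theorem weakDual_ext_W {d : ℕ} {ω ω' : WeakDual ℂ (WeylAlgebra d)}
    (h : ∀ f, ω (W f) = ω' (W f)) : ω = ω' := by
  refine DFunLike.ext _ _ fun a => ?_
  induction a using weyl_induction with
  | closed => exact isClosed_eq (map_continuous ω) (map_continuous ω')
  | weyl f => exact h f
  | zero => rw [map_zero, map_zero]
  | add a b ha hb => rw [map_add, map_add, ha, hb]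
  | smul c a ha => rw [map_smul, map_smul, ha]

/-! ### Følner sets in abelian groups -/

/-- The elements `∑ m s • s` with `0 ≤ m s ≤ n`. -/
def natCombinations {G : Type*} [AddCommGroup G] [DecidableEq G] (S : Finset G) (n : ℕ) :
    Finset G :=
  Finset.univ.image fun m : S → Fin (n + 1) => ∑ s, (m s : ℕ) • (s : G)

theorem natCombinations_subset_succ {G : Type*} [AddCommGroup G] [DecidableEq G] (S : Finset G)
    (n : ℕ) : natCombinations S n ⊆ natCombinations S (n + 1) := by
  intro x hx
  obtain ⟨m, -, rfl⟩ := Finset.mem_image.1 hx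
  exact Finset.mem_image.2 ⟨fun s => (m s).castSucc, Finset.mem_univ _, rfl⟩

theorem add_mem_natCombinations_succ {G : Type*} [AddCommGroup G] [DecidableEq G] {S : Finset G}
    {n : ℕ} {s x : G} (hs : s ∈ S) (hx : x ∈ natCombinations S n) :
    s + x ∈ natCombinations S (n + 1) := by
  obtain ⟨m, -, rfl⟩ := Finset.mem_image.1 hx
  refine Finset.mem_image.2 ⟨fun r => if r = ⟨s, hs⟩ then (m r).succ else (m r).castSucc,
    Finset.mem_univ _, ?_⟩
  have e (r : S) : ((if r = ⟨s, hs⟩ then (m r).succ else (m r).castSucc : Fin (n + 2)) : ℕ) •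
      (r : G) = (if r = ⟨s, hs⟩ then (r : G) else 0) + (m r : ℕ) • (r : G) := by
    split_ifs <;> simp [add_smul, add_comm]
  simp only [e, Finset.sum_add_distrib, Finset.sum_ite_eq', Finset.mem_univ, if_true]

theorem card_natCombinations_le {G : Type*} [AddCommGroup G] [DecidableEq G] (S : Finset G)
    (n : ℕ) : (natCombinations S n).card ≤ (n + 1) ^ S.card := by
  refine Finset.card_image_le.trans ?_
  simp

theorem natCombinations_nonempty {G : Type*} [AddCommGroup G] [DecidableEq G] (S : Finset G)
    (n : ℕ) : (natCombinations S n).Nonempty :=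
  Finset.univ_nonempty.image _

/-- Abelian groups are amenable: since the sets `natCombinations S n` grow polynomially in `n`,
some of them is almost invariant under translation by the elements of `S`. -/
theorem exists_foelner_set {G : Type*} [AddCommGroup G] [DecidableEq G] (S : Finset G) {ε : ℝ}
    (hε : 0 < ε) : ∃ F : Finset G, F.Nonempty ∧
      ∀ s ∈ S, (1 - ε) * F.card ≤ (F.filter fun y => s + y ∈ F).card := by
  obtain ⟨n, hn⟩ : ∃ n, ((natCombinations S (n + 1)).card : ℝ) ≤
      (1 + ε) * (natCombinations S n).card := by
    by_contra! hcon
    have h1 (n : ℕ) : (1 + ε) ^ n ≤ ((n : ℝ) + 1) ^ S.card := by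
      have h2 : (1 + ε) ^ n ≤ (natCombinations S n).card := by
        induction n with
        | zero =>
          rw [pow_zero]
          exact_mod_cast (natCombinations_nonempty S 0).card_pos
        | succ n ih =>
          rw [pow_succ']
          exact (mul_le_mul_of_nonneg_left ih (by positivity)).trans (hcon n).le
      exact h2.trans (by exact_mod_cast card_natCombinations_le S n)
    -- Otherwise the cardinalities grow exponentially, contrary to their polynomial bound.
    have h3 := tendsto_pow_const_div_const_pow_of_one_lt S.card (by linarith : 1 < 1 + ε)
    have h4 := (h3.comp (tendsto_add_atTop_nat 1)).eventually_lt_const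
      (by positivity : (0 : ℝ) < 1 / (1 + ε))
    obtain ⟨n, hn⟩ := h4.exists
    have h5 : 0 < (1 + ε) ^ n := by positivity
    have h6 : 0 < 1 + ε := by positivity
    simp only [Function.comp_apply, Nat.cast_add, Nat.cast_one, pow_succ] at hn
    rw [div_lt_div_iff₀ (by positivity) h6, one_mul] at hn
    have := h1 n
    nlinarith
  refine ⟨natCombinations S n, natCombinations_nonempty S n, fun s hs => ?_⟩
  set F := natCombinations S n
  -- The translates of the points of `F` that leave `F` lie in the small set `F' \ F`.
  have h1 : (F.filter fun y => s + y ∉ F).card ≤ (natCombinations S (n + 1) \ F).card := by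
    refine Finset.card_le_card_of_injOn (fun y => s + y) ?_ (add_right_injective s).injOn
    intro y hy
    obtain ⟨hy, hy'⟩ := Finset.mem_filter.1 hy
    exact Finset.mem_sdiff.2 ⟨add_mem_natCombinations_succ hs hy, hy'⟩
  have h2 := Finset.card_sdiff_add_card_eq_card (natCombinations_subset_succ S n)
  have h3 := F.card_filter_add_card_filter_not (fun y => s + y ∈ F)
  have h1' : ((F.filter fun y => s + y ∉ F).card : ℝ) ≤ (natCombinations S (n + 1) \ F).card := by
    exact_mod_cast h1
  have h2' : ((natCombinations S (n + 1) \ F).card : ℝ) + F.card =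
    (natCombinations S (n + 1)).card := by exact_mod_cast h2
  have h3' : ((F.filter fun y => s + y ∈ F).card : ℝ) + (F.filter fun y => s + y ∉ F).card =
    F.card := by exact_mod_cast h3
  linarith

/-! ### Positive definite kernels -/

open scoped ComplexOrder in
theorem posSemidef_sum_nonneg {n : Type*} {M : Matrix n n ℂ} (hM : M.PosSemidef) (s : Finset n)
    (c : n → ℂ) : 0 ≤ ∑ i ∈ s, ∑ j ∈ s, conj (c i) * M i j * c j := by
  classical
  have h := hM.2 (Finsupp.indicator s fun i _ => c i)
  rw [Finsupp.sum_of_support_subset _ (Finsupp.support_indicator_subset s _) _ (by simp)] at h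
  refine h.trans_eq (Finset.sum_congr rfl fun i hi => ?_)
  rw [Finsupp.sum_of_support_subset _ (Finsupp.support_indicator_subset s _) _ (by simp)]
  refine Finset.sum_congr rfl fun j hj => ?_
  rw [Finsupp.indicator_of_mem hi, Finsupp.indicator_of_mem hj]
  rfl

open scoped ComplexOrder in
theorem posSemidef_of_sum_nonneg {n : Type*} {M : Matrix n n ℂ} (hM : M.IsHermitian)
    (h : ∀ (s : Finset n) (c : n → ℂ), 0 ≤ ∑ i ∈ s, ∑ j ∈ s, conj (c i) * M i j * c j) :
    M.PosSemidef :=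
  ⟨hM, fun x => h x.support x⟩

open scoped ComplexOrder in
/-- Gram matrices of possibly infinite families of vectors are positive semidefinite. -/
theorem posSemidef_gram_of_infinite {n E : Type*} [NormedAddCommGroup E] [InnerProductSpace ℂ E]
    (v : n → E) : (Matrix.gram ℂ v).PosSemidef := by
  refine posSemidef_of_sum_nonneg (by ext i j; simp) fun s c => ?_
  have : ∑ i ∈ s, ∑ j ∈ s, conj (c i) * (Matrix.gram ℂ v) i j * c j =
      inner ℂ (∑ i ∈ s, c i • v i) (∑ j ∈ s, c j • v j) := by
    rw [sum_inner]
    refine Finset.sum_congr rfl fun i _ => ?_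
    rw [inner_sum]
    refine Finset.sum_congr rfl fun j _ => ?_
    rw [inner_smul_left, inner_smul_right, Matrix.gram_apply]
    ring
  rw [this, inner_self_eq_norm_sq_to_K]
  exact pow_nonneg (Complex.zero_le_real.2 (norm_nonneg (∑ i ∈ s, c i • v i))) 2

open scoped ComplexOrder in
/-- The entrywise exponential of a positive semidefinite kernel is positive semidefinite: by the
Schur product theorem, so is each entrywise power in the exponential series. -/
theorem posSemidef_map_exp {n : Type*} {M : Matrix n n ℂ} (hM : M.PosSemidef) :
    (M.map Complex.exp).PosSemidef := by
  have hpow (k : ℕ) : (M.map (· ^ k)).PosSemidef := by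
    induction k with
    | zero =>
      refine posSemidef_of_sum_nonneg (by ext i j; simp) fun s c => ?_
      have : ∑ i ∈ s, ∑ j ∈ s, conj (c i) * (M.map (· ^ 0)) i j * c j =
          star (∑ i ∈ s, c i) * ∑ j ∈ s, c j := by
        rw [star_sum, Finset.sum_mul_sum]
        simp
      rw [this]
      exact star_mul_self_nonneg _
    | succ k ih =>
      have : M.map (· ^ (k + 1)) = (M.map (· ^ k)).hadamard M := by
        ext i j
        simp [pow_succ]
      rw [this]
      exact ih.hadamard hM
  refine posSemidef_of_sum_nonneg ?_ fun s c => ?_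
  · ext i j
    rw [Matrix.conjTranspose_apply, Matrix.map_apply, Matrix.map_apply, ← hM.1.apply i j,
      Complex.star_def, ← Complex.exp_conj]
  · have key (i j : n) : HasSum (fun k : ℕ => conj (c i) * ((M i j) ^ k / k.factorial) * c j)
        (conj (c i) * Complex.exp (M i j) * c j) := by
      rw [Complex.exp_eq_exp_ℂ]
      exact ((NormedSpace.expSeries_div_hasSum_exp (M i j)).mul_left _).mul_right _
    have hs := hasSum_sum (s := s) fun i _ => hasSum_sum (s := s) fun j _ => key i j
    refine hs.nonneg fun k => ?_
    have h1 := posSemidef_sum_nonneg (hpow k) s c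
    have h2 : ∑ i ∈ s, ∑ j ∈ s, conj (c i) * ((M i j) ^ k / k.factorial) * c j =
        ((k.factorial : ℝ)⁻¹ : ℝ) • ∑ i ∈ s, ∑ j ∈ s, conj (c i) * (M.map (· ^ k)) i j * c j := by
      simp only [Finset.smul_sum, Matrix.map_apply, Complex.real_smul]
      refine Finset.sum_congr rfl fun i _ => Finset.sum_congr rfl fun j _ => ?_
      push_cast
      ring
    rw [h2]
    exact smul_nonneg (by positivity) h1

/-! ### States on the Weyl algebra with prescribed values on the Weyl operators -/

/-- The basis vector `δ_x` of `ℓ²(𝓓)`. -/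
def basisVec {d : ℕ} (x : TestFn d) : Ell2 (TestFn d) := by
  classical exact lp.single 2 x 1

theorem basisVec_apply {d : ℕ} [DecidableEq (TestFn d)] (x y : TestFn d) :
    basisVec x y = if y = x then 1 else 0 := by
  obtain rfl : ‹DecidableEq (TestFn d)› = fun a b => Classical.propDecidable (a = b) :=
    Subsingleton.elim _ _
  classical
  rw [basisVec, lp.single_apply, Pi.single_apply]

theorem inner_basisVec {d : ℕ} (x : TestFn d) (ξ : Ell2 (TestFn d)) :
    inner ℂ (basisVec x) ξ = ξ x := by
  classical
  rw [basisVec, lp.inner_single_left]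
  simp

/-- The functional `a ↦ |F|⁻¹ ∑ Φ(x, y) ⟨δ_x, a δ_y⟩`, the sum being over `x, y ∈ F`. -/
def kernelFunctional {d : ℕ} (Φ : Matrix (TestFn d) (TestFn d) ℂ) (F : Finset (TestFn d)) :
    WeakDual ℂ (WeylAlgebra d) :=
  StrongDual.toWeakDual ((F.card : ℂ)⁻¹ • ∑ x ∈ F, ∑ y ∈ F, Φ x y •
    (innerSL ℂ (basisVec x) ∘L ContinuousLinearMap.apply ℂ (Ell2 (TestFn d)) (basisVec y) ∘L
      (weylSubalgebra d).toSubalgebra.toSubmodule.subtypeL))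

theorem kernelFunctional_apply {d : ℕ} (Φ : Matrix (TestFn d) (TestFn d) ℂ)
    (F : Finset (TestFn d)) (a : WeylAlgebra d) :
    kernelFunctional Φ F a = (F.card : ℂ)⁻¹ * ∑ x ∈ F, ∑ y ∈ F, Φ x y *
      inner ℂ (basisVec x) (a.1 (basisVec y)) := by
  change ((F.card : ℂ)⁻¹ • ∑ x ∈ F, ∑ y ∈ F, Φ x y •
    (innerSL ℂ (basisVec x) ∘L ContinuousLinearMap.apply ℂ (Ell2 (TestFn d)) (basisVec y) ∘L
      (weylSubalgebra d).toSubalgebra.toSubmodule.subtypeL)) a = _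
  simp only [smul_apply, sum_apply, smul_eq_mul]
  rfl

open scoped ComplexOrder in
theorem kernelFunctional_isState {d : ℕ} {Φ : Matrix (TestFn d) (TestFn d) ℂ}
    (hΦ : Φ.PosSemidef) (h1 : ∀ x, Φ x x = 1) {F : Finset (TestFn d)} (hF : F.Nonempty) :
    IsState (kernelFunctional Φ F) := by
  classical
  constructor
  · intro a
    have h := posSemidef_sum_nonneg
      (hΦ.hadamard (posSemidef_gram_of_infinite fun x => a.1 (basisVec x))) F 1
    have e : kernelFunctional Φ F (star a * a) = ((F.card : ℝ)⁻¹ : ℝ) •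
        ∑ x ∈ F, ∑ y ∈ F, conj ((1 : TestFn d → ℂ) x) *
          (Φ.hadamard (Matrix.gram ℂ fun x => a.1 (basisVec x))) x y * (1 : TestFn d → ℂ) y := by
      rw [kernelFunctional_apply, Complex.real_smul]
      push_cast
      congr 1
      refine Finset.sum_congr rfl fun x _ => Finset.sum_congr rfl fun y _ => ?_
      change Φ x y * inner ℂ (basisVec x) ((star a.1) (a.1 (basisVec y))) = _
      rw [ContinuousLinearMap.star_eq_adjoint, ContinuousLinearMap.adjoint_inner_right]
      simp
    have h' : 0 ≤ kernelFunctional Φ F (star a * a) := by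
      rw [e]
      exact smul_nonneg (by positivity) h
    exact ⟨(Complex.nonneg_iff.1 h').1, (Complex.nonneg_iff.1 h').2.symm⟩
  · rw [kernelFunctional_apply]
    have e (x y : TestFn d) : Φ x y * inner ℂ (basisVec x) ((1 : WeylAlgebra d).1 (basisVec y)) =
        if x = y then 1 else 0 := by
      change Φ x y * inner ℂ (basisVec x) (basisVec y) = _
      rw [inner_basisVec, basisVec_apply]
      split_ifs with h
      · rw [h, h1, mul_one]
      · rw [mul_zero]
    simp only [e, Finset.sum_ite_eq, Finset.sum_ite_mem, Finset.inter_self, Finset.sum_const,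
      nsmul_eq_mul, mul_one]
    exact inv_mul_cancel₀ (by exact_mod_cast hF.card_pos.ne')

/-- The kernel on `𝓓` attached to a function `φ`. A functional with values `φ` on the Weyl
operators takes the value `weylKernel φ x y` on `W(x) W(y)*`. -/
def weylKernel {d : ℕ} (φ : TestFn d → ℂ) : Matrix (TestFn d) (TestFn d) ℂ :=
  Matrix.of fun x y => Complex.exp (I * Real.pi ^ 2 * symp x y) * φ (x - y)

theorem kernelFunctional_weylKernel_W {d : ℕ} [DecidableEq (TestFn d)] (φ : TestFn d → ℂ)
    (F : Finset (TestFn d)) (f : TestFn d) :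
    kernelFunctional (weylKernel φ) F (W f) =
      (F.card : ℂ)⁻¹ * ((F.filter fun y => f + y ∈ F).card * φ f) := by
  rw [kernelFunctional_apply, Finset.sum_comm]
  congr 1
  have e (x y : TestFn d) : weylKernel φ x y * inner ℂ (basisVec x) ((W f).1 (basisVec y)) =
      if x = f + y then φ f else 0 := by
    change weylKernel φ x y * inner ℂ (basisVec x) (weylOp f (basisVec y)) = _
    rw [inner_basisVec, weylOp_apply, basisVec_apply]
    have : -f + x = y ↔ x = f + y := neg_add_eq_iff_eq_add
    simp only [this]
    split_ifs with h
    · rw [h, weylKernel, Matrix.of_apply, symp_add_left, symp_add_right, symp_self, symp_self,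
        add_sub_cancel_right, mul_one, mul_right_comm, ← Complex.exp_add]
      simp only [add_zero, zero_add]
      rw [show I * Real.pi ^ 2 * (symp f y : ℂ) + ((-(Real.pi ^ 2 * symp f y) : ℝ) : ℂ) * I = 0 by
        push_cast; ring, Complex.exp_zero, one_mul]
    · rw [mul_zero, mul_zero]
  simp only [e, Finset.sum_ite_eq']
  rw [← Finset.sum_filter, Finset.sum_const, nsmul_eq_mul]

theorem weakDual_tendsto_apply {E ι : Type*} [NormedAddCommGroup E] [NormedSpace ℂ E]
    {l : Filter ι} {u : ι → WeakDual ℂ E} {ω : WeakDual ℂ E} (h : Tendsto u l (𝓝 ω)) (a : E) :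
    Tendsto (fun i => u i a) l (𝓝 (ω a)) :=
  ((WeakDual.eval_continuous a).tendsto ω).comp h

open scoped ComplexOrder in
/-- A function on `𝓓` whose kernel is positive semidefinite extends to a state on the Weyl algebra.
It is the limit of the states `kernelFunctional (weylKernel φ) F` along Følner sets `F`. -/
theorem exists_isState_of_posSemidef {d : ℕ} {φ : TestFn d → ℂ} (h0 : φ 0 = 1)
    (hφ : (weylKernel φ).PosSemidef) :
    ∃ ω : WeakDual ℂ (WeylAlgebra d), IsState ω ∧ ∀ f, ω (W f) = φ f := by
  classical
  -- The approximating states are indexed by a finite set of test functions and the accuracy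
  -- `1 / (n + 1)` with which translations by them preserve the Følner set.
  have hF (i : Finset (TestFn d) × ℕ) := exists_foelner_set i.1
    (by positivity : (0 : ℝ) < 1 / ((i.2 : ℝ) + 1))
  choose F hne hF using hF
  let u (i : Finset (TestFn d) × ℕ) := kernelFunctional (weylKernel φ) (F i)
  have hu (i) : IsState (u i) := kernelFunctional_isState hφ
    (fun x => by simp [weylKernel, symp_self, h0]) (hne i)
  let U : Ultrafilter (Finset (TestFn d) × ℕ) := Ultrafilter.of atTop
  obtain ⟨ω, -, hω⟩ := (WeakDual.isCompact_closedBall (𝕜 := ℂ) (E := WeylAlgebra d) 0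
    1).ultrafilter_le_nhds (U.map u) (by
      rw [Ultrafilter.coe_map, le_principal_iff]
      refine mem_map.2 (univ_mem' fun i => ?_)
      refine mem_closedBall_zero_iff.2
        (ContinuousLinearMap.opNorm_le_bound _ zero_le_one fun a => ?_)
      rw [one_mul]
      exact (hu i).norm_apply_le a)
  have hω' (a : WeylAlgebra d) : Tendsto (fun i => u i a) U (𝓝 (ω a)) :=
    weakDual_tendsto_apply hω a
  refine ⟨ω, ⟨fun a => ⟨?_, ?_⟩, ?_⟩, fun f => ?_⟩
  · exact ge_of_tendsto' ((Complex.continuous_re.tendsto _).comp (hω' _))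
      fun i => ((hu i).nonneg a).1
  · refine tendsto_nhds_unique ((Complex.continuous_im.tendsto _).comp (hω' _)) ?_
    exact tendsto_const_nhds.congr fun i => ((hu i).nonneg a).2.symm
  · refine tendsto_nhds_unique (hω' 1) ?_
    exact tendsto_const_nhds.congr fun i => (hu i).map_one.symm
  · refine tendsto_nhds_unique (hω' (W f)) ?_
    refine Tendsto.mono_left ?_ (Ultrafilter.of_le atTop)
    rw [tendsto_iff_norm_sub_tendsto_zero]
    have hlim : Tendsto (fun i : Finset (TestFn d) × ℕ => 1 / ((i.2 : ℝ) + 1) * ‖φ f‖) atTop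
        (𝓝 0) := by
      rw [← zero_mul ‖φ f‖, ← prod_atTop_atTop_eq]
      exact ((tendsto_one_div_add_atTop_nhds_zero_nat (𝕜 := ℝ)).comp tendsto_snd).mul_const _
    refine squeeze_zero' (Eventually.of_forall fun _ => norm_nonneg _) ?_ hlim
    filter_upwards [eventually_ge_atTop (({f} : Finset (TestFn d)), 0)] with i hi
    have hmem : f ∈ i.1 := hi.1 (Finset.mem_singleton_self f)
    have h1 := hF i f hmem
    have hpos : (0 : ℝ) < (F i).card := by exact_mod_cast (hne i).card_pos
    have h2 : (((F i).filter fun y => f + y ∈ F i).card : ℝ) ≤ (F i).card := by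
      exact_mod_cast Finset.card_filter_le _ _
    set q : ℝ := (((F i).filter fun y => f + y ∈ F i).card : ℝ) / (F i).card with hq
    have e : u i (W f) - φ f = ((q - 1 : ℝ) : ℂ) * φ f := by
      simp only [u]
      rw [kernelFunctional_weylKernel_W, hq]
      push_cast
      ring
    rw [e, norm_mul, Complex.norm_real, Real.norm_eq_abs]
    refine mul_le_mul_of_nonneg_right ?_ (norm_nonneg _)
    have h3 : q ≤ 1 := (div_le_one hpos).2 h2
    have h4 : 1 - 1 / ((i.2 : ℝ) + 1) ≤ q := (le_div_iff₀ hpos).2 h1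
    rw [abs_le]
    constructor <;> linarith

/-! ### The thermal form and the Gibbs kernel -/

theorem integrable_mul_conj_mul {d : ℕ} (f g : TestFn d) {m : Momentum d → ℂ}
    (hm : Continuous m) : Integrable (fun k => m k * (conj (f k) * g k)) :=
  Continuous.integrable_of_hasCompactSupport
    (hm.mul ((Complex.continuous_conj.comp f.continuous).mul g.continuous))
    (g.hasCompactSupport.mul_left.mul_left)

theorem integrable_mul_mul_conj {d : ℕ} (f g : TestFn d) {m : Momentum d → ℂ}
    (hm : Continuous m) : Integrable (fun k => m k * (f k * conj (g k))) := by
  simpa only [mul_comm (f _)] using integrable_mul_conj_mul g f hm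

theorem cothHalf_top (x : ℝ) : cothHalf ∞ x = 1 := if_pos rfl

/-- The Planck formula `coth(β x / 2) = 1 + 2 / (exp(β x) - 1)`. -/
theorem cothHalf_of_lt_top {β : ℝ≥0∞} (hβ : 0 < β) (hβ' : β < ∞) {x : ℝ} (hx : 0 < x) :
    cothHalf β x = 1 + 2 / (Real.exp (β.toReal * x) - 1) := by
  have hb : 0 < β.toReal := ENNReal.toReal_pos hβ.ne' hβ'.ne
  have h1 : 1 < Real.exp (β.toReal * x) := Real.one_lt_exp_iff.2 (by positivity)
  have h2 : 0 < Real.sinh (β.toReal * x / 2) := Real.sinh_pos_iff.2 (by positivity)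
  have h3 : Real.exp (β.toReal * x) =
      Real.exp (β.toReal * x / 2) * Real.exp (β.toReal * x / 2) := by
    rw [← Real.exp_add, add_halves]
  have h4 : Real.exp (β.toReal * x / 2) * Real.exp (-(β.toReal * x / 2)) = 1 := by
    rw [← Real.exp_add, add_neg_cancel, Real.exp_zero]
  have h5 : Real.exp (β.toReal * x) - 1 ≠ 0 := by linarith
  rw [cothHalf, if_neg hβ'.ne, div_eq_iff h2.ne', ← sub_eq_zero]
  field_simp
  rw [Real.cosh_eq, Real.sinh_eq]
  rw [h3]
  linear_combination Real.exp (β.toReal * x / 2) * h4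

theorem one_le_cothHalf {β : ℝ≥0∞} (hβ : 0 < β) {x : ℝ} (hx : 0 < x) : 1 ≤ cothHalf β x := by
  rcases eq_or_ne β ∞ with rfl | h
  · rw [cothHalf_top]
  · have hb : 0 < β.toReal := ENNReal.toReal_pos hβ.ne' h
    rw [cothHalf_of_lt_top hβ h.lt_top hx]
    have h1 : 1 < Real.exp (β.toReal * x) := Real.one_lt_exp_iff.2 (by positivity)
    have : 0 < 2 / (Real.exp (β.toReal * x) - 1) := div_pos two_pos (by linarith)
    linarith

theorem continuous_cothHalf {d : ℕ} (ϖ : Dispersion d) {β : ℝ≥0∞} (hβ : 0 < β) :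
    Continuous fun k => cothHalf β (ϖ k) := by
  have hc : Continuous ϖ := ϖ.smooth.continuous
  rcases eq_or_ne β ∞ with rfl | h
  · simp only [cothHalf_top]
    exact continuous_const
  · have hb : 0 < β.toReal := ENNReal.toReal_pos hβ.ne' h
    simp only [fun k => cothHalf_of_lt_top hβ h.lt_top (ϖ.pos k)]
    refine continuous_const.add (continuous_const.div (by fun_prop) fun k => ?_)
    have h1 : 1 < Real.exp (β.toReal * ϖ k) :=
      Real.one_lt_exp_iff.2 (mul_pos hb (ϖ.pos k))
    linarith

/-- The real bilinear form `⟨f, (c + 1)/2 g⟩ + ⟨g, (c - 1)/2 f⟩` with `c = coth(β ϖ / 2)`. The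
Gibbs state of `W(f) W(g)` differs from the product of the values at `W(f)` and `W(g)` by the
exponential of `-π²` times this form, see `exp_symp_mul_gibbsFourier_add`. -/
def gibbsKernel {d : ℕ} (ϖ : Dispersion d) (β : ℝ≥0∞) (f g : TestFn d) : ℂ :=
  ∫ k, ((((cothHalf β (ϖ k) + 1) / 2 : ℝ) : ℂ) * (conj (f k) * g k) +
    (((cothHalf β (ϖ k) - 1) / 2 : ℝ) : ℂ) * (f k * conj (g k)))

theorem integrable_gibbsKernel {d : ℕ} (ϖ : Dispersion d) {β : ℝ≥0∞} (hβ : 0 < β)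
    (f g : TestFn d) :
    Integrable fun k => ((((cothHalf β (ϖ k) + 1) / 2 : ℝ) : ℂ) * (conj (f k) * g k) +
      (((cothHalf β (ϖ k) - 1) / 2 : ℝ) : ℂ) * (f k * conj (g k))) := by
  have hc := continuous_cothHalf ϖ hβ
  exact (integrable_mul_conj_mul f g (by fun_prop)).add
    (integrable_mul_mul_conj f g (by fun_prop))

theorem integrable_thermalForm {d : ℕ} (ϖ : Dispersion d) {β : ℝ≥0∞} (hβ : 0 < β)
    (f g : TestFn d) : Integrable fun k => conj (f k) * ((cothHalf β (ϖ k) : ℂ) * g k) := by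
  have hc := continuous_cothHalf ϖ hβ
  simpa only [mul_left_comm] using integrable_mul_conj_mul f g
    (m := fun k => (cothHalf β (ϖ k) : ℂ)) (by fun_prop)

theorem two_mul_I_mul_symp {d : ℕ} (f g : TestFn d) :
    2 * I * symp f g = ∫ k, (conj (f k) * g k - f k * conj (g k)) := by
  have h : Integrable fun k => f k * conj (g k) := by
    simpa only [mul_comm (f _)] using integrable_conj_mul g f
  rw [integral_sub (integrable_conj_mul f g) h]
  have e : ∫ k, f k * conj (g k) = conj (l2Inner f g) := by
    rw [l2Inner, ← integral_conj]
    congr 1; funext k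
    simp
  rw [e]
  change _ = l2Inner f g - conj (l2Inner f g)
  rw [Complex.sub_conj, symp]
  push_cast
  ring

/-- Polarization of the thermal form, including the symplectic form. -/
theorem thermalForm_add {d : ℕ} (ϖ : Dispersion d) {β : ℝ≥0∞} (hβ : 0 < β) (f g : TestFn d) :
    thermalForm ϖ β (f + g) + 2 * I * symp f g =
      thermalForm ϖ β f + thermalForm ϖ β g + 2 * gibbsKernel ϖ β f g := by
  have h : Integrable fun k => f k * conj (g k) := by
    simpa only [mul_comm (f _)] using integrable_conj_mul g f
  have hs : Integrable fun k => conj (f k) * g k - f k * conj (g k) :=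
    (integrable_conj_mul f g).sub h
  have ht : Integrable fun k => conj (f k) * ((cothHalf β (ϖ k) : ℂ) * f k) +
      conj (g k) * ((cothHalf β (ϖ k) : ℂ) * g k) :=
    (integrable_thermalForm ϖ hβ f f).add (integrable_thermalForm ϖ hβ g g)
  rw [two_mul_I_mul_symp, thermalForm, thermalForm, thermalForm, gibbsKernel,
    ← integral_add (integrable_thermalForm ϖ hβ _ _) hs,
    ← integral_add (integrable_thermalForm ϖ hβ _ _) (integrable_thermalForm ϖ hβ _ _),
    ← integral_const_mul, ← integral_add ht ((integrable_gibbsKernel ϖ hβ f g).const_mul 2)]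
  congr 1; funext k
  simp only [add_apply, map_add]
  push_cast
  ring

theorem thermalForm_neg {d : ℕ} (ϖ : Dispersion d) (β : ℝ≥0∞) (f : TestFn d) :
    thermalForm ϖ β (-f) = thermalForm ϖ β f := by
  simp [thermalForm]

theorem conj_thermalForm {d : ℕ} (ϖ : Dispersion d) (β : ℝ≥0∞) (f : TestFn d) :
    conj (thermalForm ϖ β f) = thermalForm ϖ β f := by
  rw [thermalForm, ← integral_conj]
  congr 1; funext k
  simp only [map_mul, Complex.conj_conj, Complex.conj_ofReal]
  ring

theorem thermalForm_smul {d : ℕ} (ϖ : Dispersion d) (β : ℝ≥0∞) (r : ℝ) (f : TestFn d) :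
    thermalForm ϖ β (r • f) = r ^ 2 * thermalForm ϖ β f := by
  rw [thermalForm, thermalForm, ← integral_const_mul]
  congr 1; funext k
  change conj ((r : ℂ) * f k) * (_ * ((r : ℂ) * f k)) = _
  rw [map_mul, Complex.conj_ofReal]
  ring

theorem thermalForm_evolve {d : ℕ} (ϖ : Dispersion d) (β : ℝ≥0∞) (t : ℝ) (f : TestFn d) :
    thermalForm ϖ β (evolve ϖ t f) = thermalForm ϖ β f := by
  rw [thermalForm, thermalForm]
  congr 1; funext k
  have h : conj (Complex.exp (I * t * ϖ k)) * Complex.exp (I * t * ϖ k) = 1 := by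
    rw [← Complex.exp_conj, ← Complex.exp_add]
    simp
  rw [evolve_apply, map_mul]
  linear_combination (conj (f k) * ((cothHalf β (ϖ k) : ℂ) * f k)) * h

theorem gibbsKernel_neg_right {d : ℕ} (ϖ : Dispersion d) (β : ℝ≥0∞) (f g : TestFn d) :
    gibbsKernel ϖ β f (-g) = -gibbsKernel ϖ β f g := by
  rw [gibbsKernel, gibbsKernel, ← integral_neg]
  congr 1; funext k
  simp only [neg_apply, map_neg]
  ring

open scoped ComplexOrder in
/-- The Gibbs kernel is positive semidefinite since `coth ≥ 1`. -/
theorem gibbsKernel_posSemidef {d : ℕ} (ϖ : Dispersion d) {β : ℝ≥0∞} (hβ : 0 < β) :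
    (Matrix.of (gibbsKernel ϖ β)).PosSemidef := by
  refine posSemidef_of_sum_nonneg ?_ fun s c => ?_
  · ext f g
    rw [Matrix.conjTranspose_apply, Matrix.of_apply, Matrix.of_apply, gibbsKernel, gibbsKernel,
      Complex.star_def, ← integral_conj]
    congr 1; funext k
    simp only [map_add, map_mul, Complex.conj_conj, Complex.conj_ofReal]
    ring
  · have e1 : ∑ f ∈ s, ∑ g ∈ s, conj (c f) * Matrix.of (gibbsKernel ϖ β) f g * c g =
        ∫ k, ∑ f ∈ s, ∑ g ∈ s, conj (c f) *
          ((((cothHalf β (ϖ k) + 1) / 2 : ℝ) : ℂ) * (conj (f k) * g k) +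
            (((cothHalf β (ϖ k) - 1) / 2 : ℝ) : ℂ) * (f k * conj (g k))) * c g := by
      rw [integral_finsetSum _ fun f _ => integrable_finsetSum _ fun g _ =>
        ((integrable_gibbsKernel ϖ hβ f g).const_mul _).mul_const _]
      refine Finset.sum_congr rfl fun f _ => ?_
      rw [integral_finsetSum _ fun g _ =>
        ((integrable_gibbsKernel ϖ hβ f g).const_mul _).mul_const _]
      refine Finset.sum_congr rfl fun g _ => ?_
      rw [integral_mul_const, integral_const_mul]
      rfl
    have e2 (k : Momentum d) : ∑ f ∈ s, ∑ g ∈ s, conj (c f) *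
          ((((cothHalf β (ϖ k) + 1) / 2 : ℝ) : ℂ) * (conj (f k) * g k) +
            (((cothHalf β (ϖ k) - 1) / 2 : ℝ) : ℂ) * (f k * conj (g k))) * c g =
        (((cothHalf β (ϖ k) + 1) / 2 * ‖∑ f ∈ s, c f * f k‖ ^ 2 +
          (cothHalf β (ϖ k) - 1) / 2 * ‖∑ f ∈ s, c f * conj (f k)‖ ^ 2 : ℝ) : ℂ) := by
      rw [Complex.ofReal_add, Complex.ofReal_mul, Complex.ofReal_mul, Complex.ofReal_pow,
        Complex.ofReal_pow, ← Complex.conj_mul', ← Complex.conj_mul', map_sum, map_sum,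
        Finset.sum_mul_sum, Finset.sum_mul_sum, Finset.mul_sum, Finset.mul_sum,
        ← Finset.sum_add_distrib]
      refine Finset.sum_congr rfl fun f _ => ?_
      rw [Finset.mul_sum, Finset.mul_sum, ← Finset.sum_add_distrib]
      refine Finset.sum_congr rfl fun g _ => ?_
      simp only [map_mul, Complex.conj_conj]
      ring
    rw [e1]
    simp only [e2]
    rw [integral_complex_ofReal, Complex.zero_le_real]
    refine integral_nonneg fun k => ?_
    have h1 := one_le_cothHalf hβ (ϖ.pos k)
    have h2 : 0 ≤ (cothHalf β (ϖ k) - 1) / 2 := by linarith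
    positivity

/-! ### The Gibbs states -/

theorem pairing_neg {d : ℕ} (f : TestFn d) (T : Dist d) : pairing (-f) T = -pairing f T := by
  have h : pairing (0 : TestFn d) T = 0 := by simpa using pairing_add (0 : TestFn d) 0 T
  have h' := pairing_add (-f) f T
  rw [neg_add_cancel, h] at h'
  linear_combination -h'

theorem pairing_real_smul {d : ℕ} (r : ℝ) (f : TestFn d) (T : Dist d) :
    pairing (r • f) T = r * pairing f T := by
  have h : conjTest (r • f) = (r : ℂ) • conjTest f := by
    ext k
    change conj ((r : ℂ) * f k) = (r : ℂ) * conj (f k)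
    rw [map_mul, Complex.conj_ofReal]
  rw [pairing, h, map_smul]
  rfl

theorem gibbsFourier_neg {d : ℕ} (ϖ : Dispersion d) (v : Dist d) (β : ℝ≥0∞) (f : TestFn d) :
    gibbsFourier ϖ v β (-f) = conj (gibbsFourier ϖ v β f) := by
  rw [gibbsFourier, gibbsFourier, map_mul, ← Complex.exp_conj, ← Complex.exp_conj,
    thermalForm_neg, pairing_neg]
  simp only [map_mul, map_neg, conj_thermalForm, Complex.conj_ofReal, Complex.conj_I, map_div₀,
    map_pow, map_ofNat, Complex.neg_re, Complex.ofReal_neg]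
  congr 2
  ring

theorem gibbsFourier_zero {d : ℕ} (ϖ : Dispersion d) (v : Dist d) (β : ℝ≥0∞) :
    gibbsFourier ϖ v β 0 = 1 := by
  have h1 : thermalForm ϖ β 0 = 0 := by simp [thermalForm]
  have h2 : pairing 0 (-divDisp ϖ v) = 0 := by
    simpa using pairing_add (0 : TestFn d) 0 (-divDisp ϖ v)
  simp [gibbsFourier, h1, h2]

/-- The value of the Gibbs state on the product `W(f) W(g)`. -/
theorem exp_symp_mul_gibbsFourier_add {d : ℕ} (ϖ : Dispersion d) (v : Dist d) {β : ℝ≥0∞}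
    (hβ : 0 < β) (f g : TestFn d) :
    Complex.exp (-(I * Real.pi ^ 2 * symp f g)) * gibbsFourier ϖ v β (f + g) =
      gibbsFourier ϖ v β f * gibbsFourier ϖ v β g *
        Complex.exp (-(Real.pi ^ 2 * gibbsKernel ϖ β f g)) := by
  have h := thermalForm_add ϖ hβ f g
  simp only [gibbsFourier, ← Complex.exp_add, pairing_add, Complex.add_re]
  congr 1
  push_cast
  linear_combination (-(Real.pi : ℂ) ^ 2 / 2) * h

open scoped ComplexOrder in
theorem weylKernel_gibbsFourier_posSemidef {d : ℕ} (ϖ : Dispersion d) (v : Dist d) {β : ℝ≥0∞}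
    (hβ : 0 < β) : (weylKernel (gibbsFourier ϖ v β)).PosSemidef := by
  have h1 := posSemidef_gram_of_infinite (fun f : TestFn d => conj (gibbsFourier ϖ v β f))
  have h2 := posSemidef_map_exp ((gibbsKernel_posSemidef ϖ hβ).smul
    (by positivity : (0 : ℝ) ≤ Real.pi ^ 2))
  have e : weylKernel (gibbsFourier ϖ v β) =
      (Matrix.gram ℂ fun f : TestFn d => conj (gibbsFourier ϖ v β f)).hadamard
        ((Real.pi ^ 2 • Matrix.of (gibbsKernel ϖ β)).map Complex.exp) := by
    ext f g
    have h := exp_symp_mul_gibbsFourier_add ϖ v hβ f (-g)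
    rw [symp_neg_right, gibbsFourier_neg, gibbsKernel_neg_right, ← sub_eq_add_neg] at h
    rw [weylKernel, Matrix.of_apply, Matrix.hadamard_apply, Matrix.gram_apply, Matrix.map_apply,
      Matrix.smul_apply, Matrix.of_apply, RCLike.inner_apply, Complex.conj_conj, Complex.real_smul]
    push_cast at h ⊢
    simp only [mul_neg, neg_neg] at h
    rw [h]
    ring
  rw [e]
  exact h1.hadamard h2

theorem continuous_gibbsFourier_smul {d : ℕ} (ϖ : Dispersion d) (v : Dist d) (β : ℝ≥0∞)
    (f : TestFn d) : Continuous fun r : ℝ => gibbsFourier ϖ v β (r • f) := by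
  simp only [gibbsFourier, thermalForm_smul, pairing_real_smul, Complex.re_ofReal_mul]
  fun_prop

theorem existsUnique_isGibbsState {d : ℕ} (ϖ : Dispersion d) (v : Dist d) {β : ℝ≥0∞}
    (hβ : 0 < β) : ∃! ω : WeakDual ℂ (WeylAlgebra d), IsGibbsState ϖ v β ω := by
  obtain ⟨ω, hω, hW⟩ := exists_isState_of_posSemidef (gibbsFourier_zero ϖ v β)
    (weylKernel_gibbsFourier_posSemidef ϖ v hβ)
  refine ⟨ω, ⟨hω, fun f => ?_, hW⟩, fun ω' h => weakDual_ext_W fun f => ?_⟩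
  · simp only [hW]
    exact continuous_gibbsFourier_smul ϖ v β f
  · rw [h.fourier, hW]

/-! ### The limit of zero temperature -/

theorem cothHalf_le {β : ℝ≥0∞} (hβ : 1 ≤ β) (hβ' : β < ∞) {x : ℝ} (hx : 0 < x) :
    cothHalf β x ≤ 1 + 2 / x := by
  have hb : 1 ≤ β.toReal := by
    simpa using (ENNReal.toReal_le_toReal ENNReal.one_ne_top hβ'.ne).2 hβ
  rw [cothHalf_of_lt_top (one_pos.trans_le hβ) hβ' hx]
  have h1 := Real.add_one_le_exp (β.toReal * x)
  have h2 : x ≤ β.toReal * x := le_mul_of_one_le_left hx.le hb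
  gcongr
  linarith

theorem tendsto_cothHalf {x : ℝ} (hx : 0 < x) :
    Tendsto (fun β : ℝ≥0∞ => cothHalf β x) (𝓝[<] ∞) (𝓝 1) := by
  have h1 : Tendsto (fun β : ℝ≥0∞ => β.toReal) (𝓝[<] ∞) atTop := by
    refine tendsto_atTop.2 fun r => ?_
    filter_upwards [Ioo_mem_nhdsLT (ENNReal.ofReal_lt_top (r := r))] with β hβ
    exact (ENNReal.ofReal_le_iff_le_toReal hβ.2.ne).1 hβ.1.le
  have h2 : Tendsto (fun β : ℝ≥0∞ => 1 + 2 / (Real.exp (β.toReal * x) - 1)) (𝓝[<] ∞)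
      (𝓝 (1 + 0)) := by
    refine tendsto_const_nhds.add (tendsto_const_nhds.div_atTop ?_)
    exact tendsto_atTop_add_const_right _ _
      (Real.tendsto_exp_atTop.comp (h1.atTop_mul_const hx))
  rw [add_zero] at h2
  refine h2.congr' ?_
  filter_upwards [Ioo_mem_nhdsLT ENNReal.zero_lt_top] with β hβ
  exact (cothHalf_of_lt_top hβ.1 hβ.2 hx).symm

theorem tendsto_thermalForm {d : ℕ} (ϖ : Dispersion d) (f : TestFn d) :
    Tendsto (fun β => thermalForm ϖ β f) (𝓝[<] ∞) (𝓝 (thermalForm ϖ ∞ f)) := by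
  have hc : Continuous ϖ := ϖ.smooth.continuous
  have hb : Continuous fun k => 1 + 2 / ϖ k :=
    continuous_const.add (continuous_const.div hc fun k => (ϖ.pos k).ne')
  refine tendsto_integral_filter_of_dominated_convergence
    (fun k => ‖((1 + 2 / ϖ k : ℝ) : ℂ) * (conj (f k) * f k)‖) ?_ ?_
    (integrable_mul_conj_mul f f (by fun_prop)).norm ?_
  · filter_upwards [Ioo_mem_nhdsLT ENNReal.zero_lt_top] with β hβ
    exact (integrable_thermalForm ϖ hβ.1 f f).aestronglyMeasurable
  · filter_upwards [Ioo_mem_nhdsLT ENNReal.one_lt_top] with β hβ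
    refine Eventually.of_forall fun k => ?_
    rw [mul_left_comm, norm_mul, norm_mul _ (conj (f k) * f k), Complex.norm_real,
      Complex.norm_real]
    refine mul_le_mul_of_nonneg_right ?_ (norm_nonneg _)
    have h1 := one_le_cothHalf (one_pos.trans hβ.1) (ϖ.pos k)
    have h2 := cothHalf_le hβ.1.le hβ.2 (ϖ.pos k)
    rw [Real.norm_of_nonneg (by linarith), Real.norm_of_nonneg (by linarith)]
    exact h2
  · refine Eventually.of_forall fun k => ?_
    rw [cothHalf_top]
    exact tendsto_const_nhds.mul
      (((Complex.continuous_ofReal.tendsto _).comp (tendsto_cothHalf (ϖ.pos k))).mul_const _)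

theorem tendsto_gibbsState {d : ℕ} {ϖ : Dispersion d} {v : Dist d}
    {ω : ℝ≥0∞ → WeakDual ℂ (WeylAlgebra d)}
    (hω : ∀ β : ℝ≥0∞, 0 < β → IsGibbsState ϖ v β (ω β)) :
    Tendsto ω (𝓝[<] ∞) (𝓝 (ω ∞)) := by
  have htop := hω ∞ ENNReal.zero_lt_top
  have hpos : ∀ᶠ β in 𝓝[<] (∞ : ℝ≥0∞), 0 < β := by
    filter_upwards [Ioo_mem_nhdsLT ENNReal.zero_lt_top] with β hβ using hβ.1
  refine tendsto_iff_forall_eval_tendsto_topDualPairing.2 fun a => ?_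
  change Tendsto (fun β => ω β a) (𝓝[<] ∞) (𝓝 (ω ∞ a))
  induction a using weyl_induction with
  | closed =>
    -- The states are equicontinuous, having norm at most one.
    refine isClosed_of_closure_subset fun a ha => Metric.tendsto_nhds.2 fun ε hε => ?_
    obtain ⟨b, hb, hab⟩ := Metric.mem_closure_iff.1 ha (ε / 3) (by positivity)
    filter_upwards [Metric.tendsto_nhds.1 hb (ε / 3) (by positivity), hpos] with β h1 h2
    have h3 : dist (ω β a) (ω β b) ≤ dist a b := by
      rw [dist_eq_norm, dist_eq_norm, ← map_sub]
      exact (hω β h2).isState.norm_apply_le _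
    have h4 : dist (ω ∞ b) (ω ∞ a) ≤ dist a b := by
      rw [dist_comm a b, dist_eq_norm, dist_eq_norm, ← map_sub]
      exact htop.isState.norm_apply_le _
    have h5 := dist_triangle4 (ω β a) (ω β b) (ω ∞ b) (ω ∞ a)
    linarith
  | weyl f =>
    rw [htop.fourier]
    have h : Tendsto (fun β => gibbsFourier ϖ v β f) (𝓝[<] ∞) (𝓝 (gibbsFourier ϖ v ∞ f)) :=
      ((Complex.continuous_exp.tendsto _).comp
        ((tendsto_thermalForm ϖ f).const_mul _)).mul_const _
    refine h.congr' ?_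
    filter_upwards [hpos] with β hβ
    exact ((hω β hβ).fourier f).symm
  | zero => simp only [map_zero]; exact tendsto_const_nhds
  | add a b ha hb => simp only [map_add]; exact ha.add hb
  | smul c a ha => simp only [map_smul]; exact ha.const_smul c

/-! ### Fourier--Laplace integrals and a shift of contour -/

/-- The Fourier--Laplace integral `z ↦ ∫ h(x) exp(i u(x) z) dμ(x)`. -/
def fourierLaplace {X : Type*} [MeasurableSpace X] (μ : Measure X) (h : X → ℂ) (u : X → ℝ)
    (z : ℂ) : ℂ :=
  ∫ x, h x * Complex.exp (I * u x * z) ∂μ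

theorem integrable_fourierLaplace {X : Type*} [TopologicalSpace X] [MeasurableSpace X]
    [OpensMeasurableSpace X] {μ : Measure X} [IsFiniteMeasureOnCompacts μ] {h : X → ℂ} {u : X → ℝ}
    (hh : Continuous h) (hs : HasCompactSupport h) (hu : Continuous u) (z : ℂ) :
    Integrable (fun x => h x * Complex.exp (I * u x * z)) μ :=
  Continuous.integrable_of_hasCompactSupport (by fun_prop) hs.mul_right

theorem norm_exp_I_mul_le {u : ℝ} {z : ℂ} {R : ℝ} (hz : |z.im| ≤ R) :
    ‖Complex.exp (I * u * z)‖ ≤ Real.exp (R * |u|) := by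
  rw [Complex.norm_exp, Real.exp_le_exp]
  have : (I * u * z).re = -(z.im * u) := by simp [mul_comm]
  rw [this]
  calc -(z.im * u) ≤ |z.im * u| := neg_le_abs _
    _ = |z.im| * |u| := abs_mul _ _
    _ ≤ R * |u| := mul_le_mul_of_nonneg_right hz (abs_nonneg u)

theorem differentiable_fourierLaplace {X : Type*} [TopologicalSpace X] [MeasurableSpace X]
    [OpensMeasurableSpace X] {μ : Measure X} [IsFiniteMeasureOnCompacts μ] {h : X → ℂ} {u : X → ℝ}
    (hh : Continuous h) (hs : HasCompactSupport h) (hu : Continuous u) :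
    Differentiable ℂ (fourierLaplace μ h u) := by
  intro z₀
  refine (hasDerivAt_integral_of_dominated_loc_of_deriv_le (μ := μ)
    (F := fun z x => h x * Complex.exp (I * u x * z))
    (F' := fun z x => h x * (Complex.exp (I * u x * z) * (I * u x)))
    (bound := fun x => ‖h x‖ * (Real.exp ((‖z₀‖ + 1) * |u x|) * |u x|))
    (Metric.ball_mem_nhds z₀ one_pos)
    (Eventually.of_forall fun z => (integrable_fourierLaplace hh hs hu z).aestronglyMeasurable)
    (integrable_fourierLaplace hh hs hu z₀) ?_ ?_ ?_ ?_).2.differentiableAt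
  · exact (Continuous.integrable_of_hasCompactSupport (by fun_prop)
      hs.mul_right).aestronglyMeasurable
  · refine Eventually.of_forall fun x z hz => ?_
    have hz' : |z.im| ≤ ‖z₀‖ + 1 := by
      refine (Complex.abs_im_le_norm z).trans ?_
      have := norm_le_norm_add_norm_sub' z z₀
      rw [mem_ball_iff_norm] at hz
      linarith
    rw [norm_mul, norm_mul, norm_mul, Complex.norm_I, one_mul, Complex.norm_real,
      Real.norm_eq_abs]
    gcongr
    exact norm_exp_I_mul_le hz'
  · exact Continuous.integrable_of_hasCompactSupport (by fun_prop) hs.norm.mul_right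
  · refine Eventually.of_forall fun x z _ => ?_
    have := ((hasDerivAt_id z).const_mul (I * u x)).cexp.const_mul (h x)
    simpa using this

/-- Fourier--Laplace integrals are bounded on horizontal strips. -/
theorem norm_fourierLaplace_le {X : Type*} [TopologicalSpace X] [MeasurableSpace X]
    [OpensMeasurableSpace X] {μ : Measure X} [IsFiniteMeasureOnCompacts μ] {h : X → ℂ} {u : X → ℝ}
    (hh : Continuous h) (hs : HasCompactSupport h) (hu : Continuous u) {R : ℝ} {z : ℂ}
    (hz : |z.im| ≤ R) :
    ‖fourierLaplace μ h u z‖ ≤ ∫ x, ‖h x‖ * Real.exp (R * |u x|) ∂μ := by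
  refine norm_integral_le_of_norm_le
    (Continuous.integrable_of_hasCompactSupport (by fun_prop) hs.norm.mul_right)
    (Eventually.of_forall fun x => ?_)
  rw [norm_mul]
  gcongr
  exact norm_exp_I_mul_le hz

theorem invFourier_eq_fourierLaplace (φ : 𝓓((⊤ : Opens ℝ), ℂ)) :
    invFourier φ = fourierLaplace volume φ (fun ξ => 2 * Real.pi * ξ) := by
  funext z
  rw [invFourier, fourierLaplace]
  congr 1; funext ξ
  congr 2
  push_cast
  ring

theorem differentiable_invFourier (φ : 𝓓((⊤ : Opens ℝ), ℂ)) : Differentiable ℂ (invFourier φ) := by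
  rw [invFourier_eq_fourierLaplace]
  exact differentiable_fourierLaplace φ.continuous φ.hasCompactSupport (by fun_prop)

/-- Integration by parts in a Fourier--Laplace integral. -/
theorem mul_fourierLaplace_eq {h : ℝ → ℂ} (hh : ContDiff ℝ 1 h) (hs : HasCompactSupport h)
    (z : ℂ) :
    2 * Real.pi * I * z * fourierLaplace volume h (fun ξ => 2 * Real.pi * ξ) z =
      -fourierLaplace volume (deriv h) (fun ξ => 2 * Real.pi * ξ) z := by
  have hu : Continuous fun ξ : ℝ => 2 * Real.pi * ξ := by fun_prop
  have hd : Continuous (deriv h) := hh.continuous_deriv le_rfl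
  have hv (ξ : ℝ) : HasDerivAt
      (fun ξ : ℝ => Complex.exp (I * ((2 * Real.pi * ξ : ℝ) : ℂ) * z))
      (2 * Real.pi * I * z * Complex.exp (I * ((2 * Real.pi * ξ : ℝ) : ℂ) * z)) ξ := by
    have h1 : HasDerivAt (fun ξ : ℝ => I * ((2 * Real.pi * ξ : ℝ) : ℂ) * z)
        (2 * Real.pi * I * z) ξ := by
      have := ((((hasDerivAt_id ξ).const_mul (2 * Real.pi)).ofReal_comp).const_mul I).mul_const z
      refine this.congr_deriv ?_
      push_cast
      ring
    exact h1.cexp.congr_deriv (mul_comm _ _)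
  have h1 := integral_mul_deriv_eq_deriv_mul_of_integrable
    (u := h) (u' := deriv h)
    (fun ξ _ => (hh.differentiable one_ne_zero ξ).hasDerivAt) (fun ξ _ => hv ξ) ?_
    (integrable_fourierLaplace hd hs.deriv hu z)
    (integrable_fourierLaplace hh.continuous hs hu z)
  · rw [fourierLaplace, fourierLaplace, ← h1, ← integral_const_mul]
    congr 1; funext ξ
    ring
  · refine ((integrable_fourierLaplace hh.continuous hs hu z).const_mul
      (2 * Real.pi * I * z)).congr (Eventually.of_forall fun ξ => ?_)
    simp only [Pi.mul_apply]
    ring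

/-- The entire function `invFourier φ` decays quadratically on horizontal strips. -/
theorem exists_invFourier_decay (φ : 𝓓((⊤ : Opens ℝ), ℂ)) (R : ℝ) :
    ∃ C : ℝ, 0 ≤ C ∧ ∀ z : ℂ, |z.im| ≤ R → ‖invFourier φ z‖ ≤ C * (1 + z.re ^ 2)⁻¹ := by
  have hu : Continuous fun ξ : ℝ => 2 * Real.pi * ξ := by fun_prop
  have hφ : ContDiff ℝ 2 φ := φ.contDiff.of_le (WithTop.coe_le_coe.2 le_top)
  have hφ' : ContDiff ℝ 1 (deriv φ) := hφ.iterate_deriv' 1 1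
  set C₀ := ∫ ξ, ‖φ ξ‖ * Real.exp (R * |2 * Real.pi * ξ|)
  set C₂ := ∫ ξ, ‖deriv (deriv φ) ξ‖ * Real.exp (R * |2 * Real.pi * ξ|)
  have hC₀ : 0 ≤ C₀ := integral_nonneg fun ξ => by positivity
  have hC₂ : 0 ≤ C₂ := integral_nonneg fun ξ => by positivity
  refine ⟨C₀ + C₂, add_nonneg hC₀ hC₂, fun z hz => ?_⟩
  have h0 : ‖invFourier φ z‖ ≤ C₀ := by
    rw [invFourier_eq_fourierLaplace]
    exact norm_fourierLaplace_le φ.continuous φ.hasCompactSupport hu hz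
  have h2 : ‖(2 * Real.pi * I * z) ^ 2 * invFourier φ z‖ ≤ C₂ := by
    have e : (2 * Real.pi * I * z) ^ 2 * invFourier φ z =
        fourierLaplace volume (deriv (deriv φ)) (fun ξ => 2 * Real.pi * ξ) z := by
      rw [invFourier_eq_fourierLaplace, sq, mul_assoc,
        mul_fourierLaplace_eq (hφ.of_le one_le_two) φ.hasCompactSupport, mul_neg,
        mul_fourierLaplace_eq hφ' φ.hasCompactSupport.deriv, neg_neg]
    rw [e]
    exact norm_fourierLaplace_le (hφ'.continuous_deriv le_rfl) φ.hasCompactSupport.deriv.deriv hu hz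
  have h3 : z.re ^ 2 ≤ ‖(2 * Real.pi * I * z) ^ 2‖ := by
    have hpi : 1 ≤ 2 * Real.pi := by linarith [Real.pi_gt_three]
    rw [norm_pow, ← sq_abs]
    refine pow_le_pow_left₀ (abs_nonneg _) ?_ 2
    simp only [norm_mul, Complex.norm_I, Complex.norm_real, Complex.norm_ofNat, mul_one,
      Real.norm_eq_abs, abs_of_pos Real.pi_pos]
    exact (Complex.abs_re_le_norm z).trans (le_mul_of_one_le_left (norm_nonneg z) hpi)
  rw [← div_eq_mul_inv, le_div_iff₀ (by positivity), mul_add, mul_one]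
  refine add_le_add h0 (le_trans ?_ h2)
  rw [norm_mul, mul_comm]
  exact mul_le_mul_of_nonneg_right h3 (norm_nonneg _)

theorem integrable_of_decay {f : ℝ → ℂ} (hf : Continuous f) {C : ℝ}
    (h : ∀ t, ‖f t‖ ≤ C * (1 + t ^ 2)⁻¹) : Integrable f :=
  (integrable_inv_one_add_sq.const_mul C).mono' hf.aestronglyMeasurable
    (Eventually.of_forall h)

/-- Cauchy's theorem in a strip: the integral of an entire function over a horizontal line does
not change when the line is shifted, if the function decays quadratically in between. -/
theorem integral_eq_integral_add_I {f : ℂ → ℂ} (hf : Differentiable ℂ f) {β C : ℝ} (hβ : 0 ≤ β)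
    (h : ∀ x y : ℝ, 0 ≤ y → y ≤ β → ‖f (x + y * I)‖ ≤ C * (1 + x ^ 2)⁻¹) :
    ∫ t : ℝ, f t = ∫ t : ℝ, f (t + β * I) := by
  have hc := hf.continuous
  have i1 : Integrable fun t : ℝ => f t :=
    integrable_of_decay (by fun_prop) fun t => by simpa using h t 0 le_rfl hβ
  have i2 : Integrable fun t : ℝ => f (t + β * I) :=
    integrable_of_decay (by fun_prop) fun t => h t β hβ le_rfl
  have side (s : ℝ → ℝ) (hs : ∀ T, s T ^ 2 = T ^ 2) :
      Tendsto (fun T : ℝ => I • ∫ y : ℝ in (0 : ℝ)..β, f (s T + y * I)) atTop (𝓝 0) := by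
    have hlim : Tendsto (fun T : ℝ => C * (1 + T ^ 2)⁻¹ * |β - 0|) atTop (𝓝 (C * 0 * |β - 0|)) := by
      refine Tendsto.mul_const _ (Tendsto.const_mul _ (tendsto_inv_atTop_zero.comp ?_))
      exact tendsto_atTop_add_const_left _ _ (tendsto_pow_atTop two_ne_zero)
    rw [mul_zero, zero_mul] at hlim
    refine squeeze_zero_norm (fun T => ?_) hlim
    rw [norm_smul, Complex.norm_I, one_mul]
    refine intervalIntegral.norm_integral_le_of_norm_le_const fun y hy => ?_
    rw [Set.uIoc_of_le hβ] at hy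
    rw [← hs T]
    exact h _ y hy.1.le hy.2
  have l1 := intervalIntegral_tendsto_integral i1 tendsto_neg_atTop_atBot tendsto_id
  have l2 := intervalIntegral_tendsto_integral i2 tendsto_neg_atTop_atBot tendsto_id
  have l3 := ((l1.sub l2).add (side (fun T => T) fun _ => rfl)).sub
    (side (fun T => -T) fun T => neg_sq T)
  have hz : ∀ T : ℝ, (∫ x : ℝ in -T..T, f x) - (∫ x : ℝ in -T..T, f (x + β * I)) +
      I • (∫ y : ℝ in (0 : ℝ)..β, f (T + y * I)) -
      I • (∫ y : ℝ in (0 : ℝ)..β, f ((-T : ℝ) + y * I)) = 0 := fun T => by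
    have := Complex.integral_boundary_rect_eq_zero_of_differentiableOn f (-T : ℝ) (T + β * I)
      hf.differentiableOn
    simpa using this
  have l4 := l3.congr hz
  have := tendsto_nhds_unique l4 tendsto_const_nhds
  rw [add_zero, sub_zero] at this
  exact sub_eq_zero.1 this

/-! ### The KMS condition on Weyl operators -/

/-- The phase of the dynamics is the coboundary of the phase of the Gibbs state, so that the
Gibbs state is invariant. -/
theorem exp_sourcePhase_mul_gibbsFourier_evolve {d : ℕ} (ϖ : Dispersion d) (v : Dist d)
    (β : ℝ≥0∞) (t : ℝ) (f : TestFn d) :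
    Complex.exp (I * sourcePhase ϖ v t f) * gibbsFourier ϖ v β (evolve ϖ t f) =
      gibbsFourier ϖ v β f := by
  have hp : pairing f (mulDist (fun k => Complex.exp (I * (-t : ℝ) * ϖ k) - 1)
      (ϖ.smooth_exp_sub_one (-t)) (divDisp ϖ v)) + pairing (evolve ϖ t f) (-divDisp ϖ v) =
      pairing f (-divDisp ϖ v) := by
    have e : mulTest (fun k => Complex.exp (I * (-t : ℝ) * ϖ k) - 1)
        (ϖ.smooth_exp_sub_one (-t)) (conjTest f) = conjTest (evolve ϖ t f) - conjTest f := by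
      ext k
      have h : conj (Complex.exp (I * t * ϖ k)) = Complex.exp (I * (-t : ℝ) * ϖ k) := by
        rw [← Complex.exp_conj]
        simp
      change conj (f k) * (Complex.exp (I * (-t : ℝ) * ϖ k) - 1) =
        conj (f k * Complex.exp (I * t * ϖ k)) - conj (f k)
      rw [map_mul, h]
      ring
    change divDisp ϖ v (mulTest _ _ (conjTest f)) + -(divDisp ϖ v (conjTest (evolve ϖ t f))) =
      -(divDisp ϖ v (conjTest f))
    rw [e, map_sub]
    ring
  rw [gibbsFourier, gibbsFourier, thermalForm_evolve, ← hp, sourcePhase, mul_left_comm,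
    ← Complex.exp_add, Complex.add_re]
  congr 2
  push_cast
  ring

theorem IsGibbsState.apply_W_mul {d : ℕ} {ϖ : Dispersion d} {v : Dist d} {β : ℝ≥0∞} (hβ : 0 < β)
    {ω : WeakDual ℂ (WeylAlgebra d)} (h : IsGibbsState ϖ v β ω) (f g : TestFn d) :
    ω (W f * W g) = gibbsFourier ϖ v β f * gibbsFourier ϖ v β g *
      Complex.exp (-(Real.pi ^ 2 * gibbsKernel ϖ β f g)) := by
  rw [W_mul, map_smul, h.fourier, smul_eq_mul, exp_symp_mul_gibbsFourier_add ϖ v hβ]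

theorem IsGibbsState.apply_W_mul_dynamics {d : ℕ} {ϖ : Dispersion d} {v : Dist d} {β : ℝ≥0∞}
    (hβ : 0 < β) {ω : WeakDual ℂ (WeylAlgebra d)} (h : IsGibbsState ϖ v β ω) (g f : TestFn d)
    (t : ℝ) :
    ω (W g * vhmDynamics ϖ v t (W f)) = gibbsFourier ϖ v β g * gibbsFourier ϖ v β f *
      Complex.exp (-(Real.pi ^ 2 * gibbsKernel ϖ β g (evolve ϖ t f))) := by
  rw [vhmDynamics_W, mul_smul_comm, map_smul, smul_eq_mul, h.apply_W_mul hβ,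
    ← exp_sourcePhase_mul_gibbsFourier_evolve ϖ v β t f]
  ring

theorem IsGibbsState.apply_dynamics_mul_W {d : ℕ} {ϖ : Dispersion d} {v : Dist d} {β : ℝ≥0∞}
    (hβ : 0 < β) {ω : WeakDual ℂ (WeylAlgebra d)} (h : IsGibbsState ϖ v β ω) (g f : TestFn d)
    (t : ℝ) :
    ω (vhmDynamics ϖ v t (W f) * W g) = gibbsFourier ϖ v β g * gibbsFourier ϖ v β f *
      Complex.exp (-(Real.pi ^ 2 * gibbsKernel ϖ β (evolve ϖ t f) g)) := by
  rw [vhmDynamics_W, smul_mul_assoc, map_smul, smul_eq_mul, h.apply_W_mul hβ,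
    ← exp_sourcePhase_mul_gibbsFourier_evolve ϖ v β t f]
  ring

/-- The extension of `t ↦ gibbsKernel ϖ β g (evolve ϖ t f)` to complex times. -/
def gibbsKernelExt {d : ℕ} (ϖ : Dispersion d) (β : ℝ≥0∞) (g f : TestFn d) (z : ℂ) : ℂ :=
  fourierLaplace volume
      (fun k => (((cothHalf β (ϖ k) + 1) / 2 : ℝ) : ℂ) * (conj (g k) * f k)) ϖ z +
    fourierLaplace volume
      (fun k => (((cothHalf β (ϖ k) - 1) / 2 : ℝ) : ℂ) * (g k * conj (f k))) (fun k => -ϖ k) z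

theorem hasCompactSupport_mul_conj_mul {d : ℕ} (m : Momentum d → ℂ) (g f : TestFn d) :
    HasCompactSupport fun k => m k * (conj (g k) * f k) :=
  f.hasCompactSupport.mul_left.mul_left

theorem hasCompactSupport_mul_mul_conj {d : ℕ} (m : Momentum d → ℂ) (g f : TestFn d) :
    HasCompactSupport fun k => m k * (g k * conj (f k)) :=
  g.hasCompactSupport.mul_right.mul_left

theorem continuous_mul_conj_mul {d : ℕ} {m : Momentum d → ℂ} (hm : Continuous m)
    (g f : TestFn d) : Continuous fun k => m k * (conj (g k) * f k) :=
  hm.mul ((Complex.continuous_conj.comp g.continuous).mul f.continuous)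

theorem continuous_mul_mul_conj {d : ℕ} {m : Momentum d → ℂ} (hm : Continuous m)
    (g f : TestFn d) : Continuous fun k => m k * (g k * conj (f k)) :=
  hm.mul (g.continuous.mul (Complex.continuous_conj.comp f.continuous))

theorem differentiable_gibbsKernelExt {d : ℕ} (ϖ : Dispersion d) {β : ℝ≥0∞} (hβ : 0 < β)
    (g f : TestFn d) : Differentiable ℂ (gibbsKernelExt ϖ β g f) := by
  have hc := continuous_cothHalf ϖ hβ
  have hϖ : Continuous ϖ := ϖ.smooth.continuous
  exact (differentiable_fourierLaplace (continuous_mul_conj_mul (by fun_prop) g f)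
    (hasCompactSupport_mul_conj_mul _ g f) hϖ).add
    (differentiable_fourierLaplace (continuous_mul_mul_conj (by fun_prop) g f)
    (hasCompactSupport_mul_mul_conj _ g f) hϖ.neg)

theorem exists_norm_gibbsKernelExt_le {d : ℕ} (ϖ : Dispersion d) {β : ℝ≥0∞} (hβ : 0 < β)
    (g f : TestFn d) (R : ℝ) :
    ∃ C : ℝ, ∀ z : ℂ, |z.im| ≤ R → ‖gibbsKernelExt ϖ β g f z‖ ≤ C := by
  have hc := continuous_cothHalf ϖ hβ
  have hϖ : Continuous ϖ := ϖ.smooth.continuous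
  exact ⟨_, fun z hz => norm_add_le_of_le
    (norm_fourierLaplace_le (continuous_mul_conj_mul (by fun_prop) g f)
      (hasCompactSupport_mul_conj_mul _ g f) hϖ hz)
    (norm_fourierLaplace_le (continuous_mul_mul_conj (by fun_prop) g f)
      (hasCompactSupport_mul_mul_conj _ g f) hϖ.neg hz)⟩

theorem gibbsKernelExt_eq_integral {d : ℕ} (ϖ : Dispersion d) {β : ℝ≥0∞} (hβ : 0 < β)
    (g f : TestFn d) (z : ℂ) :
    gibbsKernelExt ϖ β g f z =
      ∫ k, ((((cothHalf β (ϖ k) + 1) / 2 : ℝ) : ℂ) * (conj (g k) * f k) *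
          Complex.exp (I * ϖ k * z) +
        (((cothHalf β (ϖ k) - 1) / 2 : ℝ) : ℂ) * (g k * conj (f k)) *
          Complex.exp (I * (-ϖ k : ℝ) * z)) := by
  have hc := continuous_cothHalf ϖ hβ
  have hϖ : Continuous ϖ := ϖ.smooth.continuous
  exact (integral_add (integrable_fourierLaplace (continuous_mul_conj_mul (by fun_prop) g f)
    (hasCompactSupport_mul_conj_mul _ g f) hϖ z)
    (integrable_fourierLaplace (continuous_mul_mul_conj (by fun_prop) g f)
    (hasCompactSupport_mul_mul_conj _ g f) hϖ.neg z)).symm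

theorem conj_exp_I_mul (t x : ℝ) :
    conj (Complex.exp (I * t * x)) = Complex.exp (I * (-x : ℝ) * t) := by
  rw [← Complex.exp_conj]
  congr 1
  simp only [map_mul, Complex.conj_I, Complex.conj_ofReal]
  push_cast
  ring

theorem gibbsKernelExt_ofReal {d : ℕ} (ϖ : Dispersion d) {β : ℝ≥0∞} (hβ : 0 < β)
    (g f : TestFn d) (t : ℝ) :
    gibbsKernelExt ϖ β g f t = gibbsKernel ϖ β g (evolve ϖ t f) := by
  rw [gibbsKernelExt_eq_integral ϖ hβ, gibbsKernel]
  congr 1; funext k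
  rw [evolve_apply, map_mul, conj_exp_I_mul, mul_right_comm I (ϖ k : ℂ)]
  ring

/-- The KMS condition at the level of two-point functions: since
`(c + 1) / 2 * exp(-β ϖ) = (c - 1) / 2` for `c = coth(β ϖ / 2)`, a shift of time by `i β`
exchanges the arguments. -/
theorem gibbsKernelExt_add_I {d : ℕ} (ϖ : Dispersion d) {β : ℝ≥0∞} (hβ : 0 < β) (hβ' : β < ∞)
    (g f : TestFn d) (t : ℝ) :
    gibbsKernelExt ϖ β g f (t + β.toReal * I) = gibbsKernel ϖ β (evolve ϖ t f) g := by
  rw [gibbsKernelExt_eq_integral ϖ hβ, gibbsKernel]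
  congr 1; funext k
  have hb : 0 < β.toReal := ENNReal.toReal_pos hβ.ne' hβ'.ne
  have h1 : 1 < Real.exp (β.toReal * ϖ k) := Real.one_lt_exp_iff.2 (mul_pos hb (ϖ.pos k))
  have h2 : (cothHalf β (ϖ k) + 1) / 2 =
      (cothHalf β (ϖ k) - 1) / 2 * Real.exp (β.toReal * ϖ k) := by
    rw [cothHalf_of_lt_top hβ hβ' (ϖ.pos k)]
    have h3 : Real.exp (β.toReal * ϖ k) - 1 ≠ 0 := by linarith
    field_simp
    ring
  have e1 : Complex.exp (I * ϖ k * (t + β.toReal * I)) =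
      Complex.exp (I * t * ϖ k) * ((Real.exp (β.toReal * ϖ k) : ℝ) : ℂ)⁻¹ := by
    rw [← Complex.ofReal_inv, ← Real.exp_neg, Complex.ofReal_exp, ← Complex.exp_add]
    congr 1
    push_cast
    linear_combination (ϖ k * β.toReal : ℂ) * I_mul_I
  have e2 : Complex.exp (I * (-ϖ k : ℝ) * (t + β.toReal * I)) =
      Complex.exp (I * (-ϖ k : ℝ) * t) * ((Real.exp (β.toReal * ϖ k) : ℝ) : ℂ) := by
    rw [Complex.ofReal_exp, ← Complex.exp_add]
    congr 1
    push_cast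
    linear_combination (-(ϖ k * β.toReal) : ℂ) * I_mul_I
  have hne : ((Real.exp (β.toReal * ϖ k) : ℝ) : ℂ) ≠ 0 :=
    Complex.ofReal_ne_zero.2 (Real.exp_ne_zero _)
  rw [evolve_apply, map_mul, conj_exp_I_mul, e1, e2, h2, Complex.ofReal_mul]
  field_simp
  ring

theorem IsGibbsState.kms_W {d : ℕ} {ϖ : Dispersion d} {v : Dist d} {β : ℝ≥0∞} (hβ : 0 < β)
    (hβ' : β < ∞) {ω : WeakDual ℂ (WeylAlgebra d)} (h : IsGibbsState ϖ v β ω)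
    (φ : 𝓓((⊤ : Opens ℝ), ℂ)) (g f : TestFn d) :
    ∫ t : ℝ, invFourier φ (t - I * β.toReal) * ω (W g * vhmDynamics ϖ v t (W f)) =
      ∫ t : ℝ, invFourier φ t * ω (vhmDynamics ϖ v t (W f) * W g) := by
  set c := gibbsFourier ϖ v β g * gibbsFourier ϖ v β f
  set b := β.toReal
  obtain ⟨C, hC, hF⟩ := exists_invFourier_decay φ b
  obtain ⟨D, hD⟩ := exists_norm_gibbsKernelExt_le ϖ hβ g f b
  -- On the real line `G` is the left integrand, on the line `Im z = b` it is the right one.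
  let G (z : ℂ) : ℂ := invFourier φ (z - I * b) *
    (c * Complex.exp (-(Real.pi ^ 2 * gibbsKernelExt ϖ β g f z)))
  have hG : Differentiable ℂ G :=
    ((differentiable_invFourier φ).comp (differentiable_id.sub_const _)).mul
      ((((differentiable_gibbsKernelExt ϖ hβ g f).const_mul _).neg.cexp).const_mul c)
  have key := integral_eq_integral_add_I hG (β := b) (C := C * (‖c‖ * Real.exp (Real.pi ^ 2 * D)))
    ENNReal.toReal_nonneg fun x y hy hyb => by
      have h1 := hF (x + y * I - I * b) (by
        simp only [sub_im, add_im, ofReal_im, mul_im, ofReal_re, I_im, I_re]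
        rw [abs_le]
        constructor <;> linarith)
      have h2 := hD (x + y * I) (by
        simp only [add_im, ofReal_im, mul_im, ofReal_re, I_im, I_re]
        rw [abs_le]
        constructor <;> linarith)
      have e : ((x : ℂ) + y * I - I * b).re = x := by simp
      rw [e] at h1
      have h3 : ‖Complex.exp (-(Real.pi ^ 2 * gibbsKernelExt ϖ β g f (x + y * I)))‖ ≤
          Real.exp (Real.pi ^ 2 * D) := by
        refine (Complex.norm_exp_le_exp_norm _).trans (Real.exp_le_exp.2 ?_)
        rw [norm_neg, norm_mul, norm_pow, Complex.norm_real, Real.norm_eq_abs, sq_abs]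
        gcongr
      rw [norm_mul, norm_mul, mul_right_comm]
      gcongr
  calc _ = ∫ t : ℝ, G t := by
        congr 1; funext t
        rw [h.apply_W_mul_dynamics hβ, ← gibbsKernelExt_ofReal ϖ hβ]
    _ = ∫ t : ℝ, G (t + b * I) := key
    _ = _ := by
        congr 1; funext t
        rw [h.apply_dynamics_mul_W hβ, ← gibbsKernelExt_add_I ϖ hβ hβ']
        simp only [G]
        congr 2
        ring

theorem IsGibbsState.continuous_W_mul_dynamics {d : ℕ} {ϖ : Dispersion d} {v : Dist d}
    {β : ℝ≥0∞} (hβ : 0 < β) {ω : WeakDual ℂ (WeylAlgebra d)} (h : IsGibbsState ϖ v β ω)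
    (g f : TestFn d) : Continuous fun t : ℝ => ω (W g * vhmDynamics ϖ v t (W f)) := by
  have hc := (differentiable_gibbsKernelExt ϖ hβ g f).continuous
  simp only [h.apply_W_mul_dynamics hβ, ← gibbsKernelExt_ofReal ϖ hβ]
  fun_prop

theorem IsGibbsState.continuous_dynamics_mul_W {d : ℕ} {ϖ : Dispersion d} {v : Dist d}
    {β : ℝ≥0∞} (hβ : 0 < β) (hβ' : β < ∞) {ω : WeakDual ℂ (WeylAlgebra d)}
    (h : IsGibbsState ϖ v β ω) (g f : TestFn d) :
    Continuous fun t : ℝ => ω (vhmDynamics ϖ v t (W f) * W g) := by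
  have hc := (differentiable_gibbsKernelExt ϖ hβ g f).continuous
  simp only [h.apply_dynamics_mul_W hβ, ← gibbsKernelExt_add_I ϖ hβ hβ']
  fun_prop

/-! ### Extension of the KMS condition to the Weyl algebra -/

/-- A bilinear map with values in functions of time which is bounded uniformly in time. -/
def UniformlyBounded {A : Type*} [SeminormedAddCommGroup A] [Module ℂ A]
    (L : A →ₗ[ℂ] A →ₗ[ℂ] (ℝ → ℂ)) : Prop :=
  ∀ a b t, ‖L a b t‖ ≤ ‖a‖ * ‖b‖

theorem isClosed_setOf_continuous {A : Type*} [SeminormedAddCommGroup A] [Module ℂ A]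
    {L : A →ₗ[ℂ] (ℝ → ℂ)} {C : ℝ} (hC : 0 ≤ C) (hL : ∀ a t, ‖L a t‖ ≤ C * ‖a‖) :
    IsClosed {a | Continuous (L a)} := by
  refine isClosed_of_closure_subset fun a ha => ?_
  refine continuous_of_uniform_approx_of_continuous fun u hu => ?_
  obtain ⟨ε, hε, hu⟩ := Metric.mem_uniformity_dist.1 hu
  obtain ⟨b, hb, hab⟩ := Metric.mem_closure_iff.1 ha (ε / (C + 1)) (by positivity)
  refine ⟨L b, hb, fun t => hu ?_⟩
  have e : L a t - L b t = L (a - b) t := by rw [map_sub]; rfl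
  rw [dist_eq_norm, e]
  rw [dist_eq_norm, lt_div_iff₀ (by positivity)] at hab
  have := hL (a - b) t
  nlinarith [norm_nonneg (a - b)]

theorem continuous_of_continuous_W {d : ℕ}
    {L : WeylAlgebra d →ₗ[ℂ] WeylAlgebra d →ₗ[ℂ] (ℝ → ℂ)} (hL : UniformlyBounded L)
    (hW : ∀ f g, Continuous (L (W f) (W g))) (a b : WeylAlgebra d) : Continuous (L a b) := by
  induction a using weyl_induction with
  | closed =>
    exact isClosed_setOf_continuous (L := L.flip b) (norm_nonneg b) fun a t =>
      (hL a b t).trans_eq (mul_comm _ _)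
  | weyl f =>
    induction b using weyl_induction with
    | closed => exact isClosed_setOf_continuous (norm_nonneg (W f)) (hL (W f))
    | weyl g => exact hW f g
    | zero => rw [map_zero]; exact continuous_const
    | add a b ha hb => rw [map_add]; exact ha.add hb
    | smul c a ha => rw [map_smul]; exact ha.const_smul c
  | zero => rw [map_zero]; exact continuous_const
  | add a a' ha hb => rw [map_add, LinearMap.add_apply]; exact ha.add hb
  | smul c a ha => rw [map_smul, LinearMap.smul_apply]; exact ha.const_smul c

theorem integrable_mul_of_bounded {F G : ℝ → ℂ} (hF : Integrable F) (hG : Continuous G) {C : ℝ}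
    (h : ∀ t, ‖G t‖ ≤ C) : Integrable fun t => F t * G t :=
  hF.mul_bdd (c := C) hG.aestronglyMeasurable (Eventually.of_forall h)

/-- Integration of a uniformly bounded bilinear map against an integrable function of time. -/
def integralBilin {A : Type*} [NormedAddCommGroup A] [NormedSpace ℂ A]
    {L : A →ₗ[ℂ] A →ₗ[ℂ] (ℝ → ℂ)} (hL : UniformlyBounded L) (hc : ∀ a b, Continuous (L a b))
    {F : ℝ → ℂ} (hF : Integrable F) : A →L[ℂ] A →L[ℂ] ℂ :=
  have hi (a b : A) : Integrable fun t => F t * L a b t :=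
    integrable_mul_of_bounded hF (hc a b) (hL a b)
  LinearMap.mkContinuous₂ (LinearMap.mk₂ ℂ (fun a b => ∫ t, F t * L a b t)
    (fun a a' b => by
      rw [← integral_add (hi a b) (hi a' b)]
      simp [mul_add])
    (fun c a b => by
      rw [smul_eq_mul, ← integral_const_mul]
      simp [mul_left_comm])
    (fun a b b' => by
      rw [← integral_add (hi a b) (hi a b')]
      simp [mul_add])
    (fun c a b => by
      rw [smul_eq_mul, ← integral_const_mul]
      simp [mul_left_comm])) (∫ t, ‖F t‖) fun a b => by
    rw [mul_assoc, ← integral_mul_const]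
    refine norm_integral_le_of_norm_le (hF.norm.mul_const _) (Eventually.of_forall fun t => ?_)
    rw [norm_mul]
    exact mul_le_mul_of_nonneg_left (hL a b t) (norm_nonneg _)

theorem bilin_ext_W {d : ℕ} {B B' : WeylAlgebra d →L[ℂ] WeylAlgebra d →L[ℂ] ℂ}
    (h : ∀ f g, B (W f) (W g) = B' (W f) (W g)) : B = B' := by
  ext a b
  induction a using weyl_induction with
  | closed => exact isClosed_eq (B.flip b).continuous (B'.flip b).continuous
  | weyl f =>
    induction b using weyl_induction with
    | closed => exact isClosed_eq (B (W f)).continuous (B' (W f)).continuous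
    | weyl g => exact h f g
    | zero => rw [map_zero, map_zero]
    | add a b ha hb => rw [map_add, map_add, ha, hb]
    | smul c a ha => rw [map_smul, map_smul, ha]
  | zero => rw [map_zero, map_zero]
  | add a a' ha hb => rw [map_add, map_add, add_apply, add_apply, ha, hb]
  | smul c a ha => rw [map_smul, map_smul, smul_apply, smul_apply, ha]

/-- The correlation function `t ↦ ω(a τ(t)[b])`, as a bilinear map in `(a, b)`. -/
def correlationLeft {A : Type*} [CStarAlgebra A] (τ : ℝ → A ≃⋆ₐ[ℂ] A) (ω : WeakDual ℂ A) :
    A →ₗ[ℂ] A →ₗ[ℂ] (ℝ → ℂ) :=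
  LinearMap.mk₂ ℂ (fun a b t => ω (a * τ t b))
    (fun a a' b => by funext t; simp [add_mul])
    (fun c a b => by funext t; simp)
    (fun a b b' => by funext t; simp [mul_add])
    (fun c a b => by funext t; simp)

/-- The correlation function `t ↦ ω(τ(t)[b] a)`, as a bilinear map in `(a, b)`. -/
def correlationRight {A : Type*} [CStarAlgebra A] (τ : ℝ → A ≃⋆ₐ[ℂ] A) (ω : WeakDual ℂ A) :
    A →ₗ[ℂ] A →ₗ[ℂ] (ℝ → ℂ) :=
  LinearMap.mk₂ ℂ (fun a b t => ω (τ t b * a))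
    (fun a a' b => by funext t; simp [mul_add])
    (fun c a b => by funext t; simp)
    (fun a b b' => by funext t; simp [add_mul])
    (fun c a b => by funext t; simp)

theorem correlationLeft_uniformlyBounded {A : Type*} [CStarAlgebra A] (τ : ℝ → A ≃⋆ₐ[ℂ] A)
    {ω : WeakDual ℂ A} (hω : IsState ω) : UniformlyBounded (correlationLeft τ ω) :=
  fun a b t => ((hω.norm_apply_le _).trans (norm_mul_le a (τ t b))).trans
    (mul_le_mul_of_nonneg_left (NonUnitalStarAlgHom.norm_apply_le (τ t) b) (norm_nonneg a))

theorem correlationRight_uniformlyBounded {A : Type*} [CStarAlgebra A] (τ : ℝ → A ≃⋆ₐ[ℂ] A)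
    {ω : WeakDual ℂ A} (hω : IsState ω) : UniformlyBounded (correlationRight τ ω) :=
  fun a b t => (((hω.norm_apply_le _).trans (norm_mul_le (τ t b) a)).trans
    (mul_le_mul_of_nonneg_right (NonUnitalStarAlgHom.norm_apply_le (τ t) b)
      (norm_nonneg a))).trans_eq (mul_comm _ _)

theorem integrable_invFourier_sub {φ : 𝓓((⊤ : Opens ℝ), ℂ)} (β : ℝ) :
    Integrable fun t : ℝ => invFourier φ (t - I * β) := by
  obtain ⟨C, -, hF⟩ := exists_invFourier_decay φ |β|
  refine integrable_of_decay ((differentiable_invFourier φ).continuous.comp (by fun_prop)) (C := C)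
    fun t => ?_
  have := hF (t - I * β) (by simp)
  simpa using this

theorem IsGibbsState.isKMSState {d : ℕ} {ϖ : Dispersion d} {v : Dist d} {β : ℝ≥0∞} (hβ : 0 < β)
    (hβ' : β < ∞) {ω : WeakDual ℂ (WeylAlgebra d)} (h : IsGibbsState ϖ v β ω) :
    IsKMSState (vhmDynamics ϖ v) β.toReal ω := by
  have bl := correlationLeft_uniformlyBounded (vhmDynamics ϖ v) h.isState
  have br := correlationRight_uniformlyBounded (vhmDynamics ϖ v) h.isState
  have cl := continuous_of_continuous_W bl fun g f => h.continuous_W_mul_dynamics hβ g f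
  have cr := continuous_of_continuous_W br fun g f => h.continuous_dynamics_mul_W hβ hβ' g f
  have il (φ : 𝓓((⊤ : Opens ℝ), ℂ)) : Integrable fun t : ℝ => invFourier φ (t - I * β.toReal) :=
    integrable_invFourier_sub _
  have ir (φ : 𝓓((⊤ : Opens ℝ), ℂ)) : Integrable fun t : ℝ => invFourier φ t := by
    simpa using integrable_invFourier_sub (φ := φ) 0
  refine ⟨h.isState, fun φ a b => integrable_mul_of_bounded (il φ) (cl a b) (bl a b),
    fun φ a b => integrable_mul_of_bounded (ir φ) (cr a b) (br a b), fun φ a b => ?_⟩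
  have e : integralBilin bl cl (il φ) = integralBilin br cr (ir φ) :=
    bilin_ext_W fun g f => h.kms_W hβ hβ' φ g f
  exact congrArg (fun B : WeylAlgebra d →L[ℂ] WeylAlgebra d →L[ℂ] ℂ => B a b) e

end VanHove

theorem mainTheorem3 (d : ℕ) (ϖ : VanHove.Dispersion d) (v : VanHove.Dist d) :
    (∀ β : ℝ≥0∞, 0 < β → ∃! ω : WeakDual ℂ (VanHove.WeylAlgebra d),
      VanHove.IsGibbsState ϖ v β ω) ∧
    ∀ ω : ℝ≥0∞ → WeakDual ℂ (VanHove.WeylAlgebra d),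
      (∀ β : ℝ≥0∞, 0 < β → VanHove.IsGibbsState ϖ v β (ω β)) →
      (∀ β : ℝ≥0∞, 0 < β → β < ∞ →
        VanHove.IsKMSState (VanHove.vhmDynamics ϖ v) β.toReal (ω β)) ∧
      Tendsto ω (𝓝[<] ∞) (𝓝 (ω ∞)) :=
  ⟨fun _ hβ => VanHove.existsUnique_isGibbsState ϖ v hβ, fun _ hω =>
    ⟨fun β hβ hβ' => (hω β hβ).isKMSState hβ hβ', VanHove.tendsto_gibbsState hω⟩⟩
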